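/- **Conventions.** Let $A$ be a principal ideal domain. For a group $G$ let $C^*(BG;A)$ be the normalized simplicial cochain algebra of the classifying space $BG$: $C^n$ consists of the functions $f\colon G^n\to A$ with $f(g_1,\ldots,g_n)=0$ whenever some $g_i=1$, with the simplicial coboundary $\delta f=\sum_{i}(-1)^i f\circ\partial_i$ and the cup product $(f\smile f')(g_1,\ldots,g_{m+n})=f(g_1,\ldots,g_m)f'(g_{m+1},\ldots,g_{m+n})$. Its augmentation ideal is $\overline{C}=\bigoplus_{n\ge 1}C^n$. Let $\mathrm{Bar}(G;A)=\bigoplus_{p\ge 0}(s^{-1}\overline{C})^{\otimes p}$ be its bar construction, in which $c\in C^n$ has degree $\|c\|=n-1$, with differential $d=d_1+d_2$, $$d_1(c_1|\ldots|c_p)=-\sum_{i=1}^{p}(-1)^{\|c_1\|+\ldots+\|c_{i-1}\|}c_1|\ldots|\delta c_i|\ldots|c_p,$$ $$d_2(c_1|\ldots|c_p)=-\sum_{i=1}^{p-1}(-1)^{\|c_1\|+\ldots+\|c_i\|}c_1|\ldots|(c_i\smile c_{i+1})|\ldots|c_p,$$ and let $H^0_{Bar}(G;A)$ be its cohomology in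 degree $0$. Since $\mathrm{Bar}(G;A)$ vanishes in negative degrees, this is the $A$-module of cocycles of degree $0$. It is a coalgebra under deconcatenation $\Delta(c_1|\ldots|c_p)=\sum_{i=0}^p(c_1|\ldots|c_i)\otimes(c_{i+1}|\ldots|c_p)$, with counit $\eta$ the projection to the summand $p=0$ and with the element $1$ of that summand as coaugmentation. A class $T$ is *reduced* if $\eta(T)=0$; for such $T$ let $\overline{\Delta}(T)=\Delta(T)-1\otimes T-T\otimes 1$. Let $\overline{\Delta}{}^0=\mathrm{id}$ and $\overline{\Delta}{}^{n+1}=(\overline{\Delta}\otimes\mathrm{id}^{\otimes n})\circ\overline{\Delta}{}^{n}$. A homomorphism $h\colon G\to G'$ induces a coalgebra map $h^*\colon H^0_{Bar}(G';A)\to H^0_{Bar}(G;A)$ by pulling back cochains. For $w\in G$ and $T\in H^0_{Bar}(G;A)$, the letter-braiding polynomial $L_T(w)\in A[t]$ is the image of $T$ under the linear map with $c_1|\ldots|c_p\mapsto c_1(w)\cdots c_p(w)\,t^p$ for $c_i\in C^1$; this is the pullback of $T$ along the edge $w\colon S^1\to BG$. The letter-braiding number $\ell_T(w)\in A$ is the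 coefficient of $t$ in $L_T(w)$. The functional $\langle T,\bullet\rangle\colon A[G]\to A$ is the linear extension of $w\mapsto\ell_T(w)+\eta(T)$. For $w_0,\ldots,w_n\in G$, $n\ge 0$, and $T$ reduced, the multi-evaluation $\ell_T(w_0|\ldots|w_n)\in A$ is obtained by applying $T_0\otimes\ldots\otimes T_n\mapsto\ell_{T_0}(w_0)\cdots\ell_{T_n}(w_n)$ to $\overline{\Delta}{}^n(T)$. **Theorem (lifting criterion).** Let $\Gamma_0$ be a group, $R\subseteq\Gamma_0$ a subset, $\langle R\rangle$ the normal subgroup generated by $R$, $\Gamma=\Gamma_0/\langle R\rangle$, and $p\colon\Gamma_0\to\Gamma$ the quotient map. Then the coalgebra map $$p^*\colon H^0_{Bar}(\Gamma;A)\to H^0_{Bar}(\Gamma_0;A)$$ is injective and its image is a subcoalgebra, that is, $\Delta(\operatorname{im}p^*)$ lies in the image of $\operatorname{im}p^*\otimes\operatorname{im}p^*$. Moreover, for every $T\in H^0_{Bar}(\Gamma_0;A)$ with $\eta(T)=0$ the following are equivalent: 1. $T\in p^*H^0_{Bar}(\Gamma;A)$. 2. One can write $\overline{\Delta}(T)=\sum_{i=1}^m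 T_1^i\otimes T_2^i$ with all $T_1^i$ and $T_2^i$ in $p^*H^0_{Bar}(\Gamma;A)$, and moreover $\ell_T(r)=0$ for all $r\in R$. 3. The functional $\langle T,\bullet\rangle\colon A[\Gamma_0]\to A$ factors through the projection $p_*\colon A[\Gamma_0]\to A[\Gamma]$. 4. $\ell_T(w_0|\ldots|w_n)=0$ for every $n\ge 0$ and every sequence $w_0,\ldots,w_n\in\Gamma_0$ at least one of whose members belongs to $R$. -/

import Mathlib

open scoped TensorProduct DirectSum

noncomputable section
namespace LetterBraiding

section Tensor
universe u v
variable {A : Type u} [CommRing A] {W : Type v} [AddCommMonoid W] [Module A W]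

local notation "letter" => TensorAlgebra.ι A

/-- Auxiliary: the algebra map by which a letter `c` acts as `(x, m) ↦ (c|x, step c (x, m))`. -/
def tensorRecAux {M : Type*} [AddCommMonoid M] [Module A M]
    (step : W →ₗ[A] TensorAlgebra A W × M →ₗ[A] M) :
    TensorAlgebra A W →ₐ[A] Module.End A (TensorAlgebra A W × M) :=
  TensorAlgebra.lift A
      { toFun := fun c => LinearMap.prod
          (LinearMap.mulLeft A (letter c) ∘ₗ LinearMap.fst A (TensorAlgebra A W) M) (step c)
        map_add' := fun c c' => by
          ext <;> simp [add_mul]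
        map_smul' := fun a c => by
          ext <;> simp }

/-- Recursion on words: the linear map `f` on the tensor algebra `T(W) = ⨁ W^{⊗p}` with `f 1 = m₀` and
`f (c|x) = step c (x, f x)` for a letter `c` and a tensor `x`. -/
def tensorRec {M : Type*} [AddCommMonoid M] [Module A M] (m₀ : M)
    (step : W →ₗ[A] TensorAlgebra A W × M →ₗ[A] M) : TensorAlgebra A W →ₗ[A] M :=
  LinearMap.snd A (TensorAlgebra A W) M ∘ₗ
    LinearMap.applyₗ ((1, m₀) : TensorAlgebra A W × M) ∘ₗ (tensorRecAux step).toLinearMap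

section
variable {M : Type*} [AddCommMonoid M] [Module A M] (m₀ : M)
    (step : W →ₗ[A] TensorAlgebra A W × M →ₗ[A] M)

@[simp] theorem tensorRec_one : tensorRec m₀ step 1 = m₀ := by
  simp [tensorRec]

theorem tensorRecAux_fst (x : TensorAlgebra A W) (y : TensorAlgebra A W × M) :
    (tensorRecAux step x y).1 = x * y.1 := by
  revert y
  refine TensorAlgebra.induction (R := A) (M := W)
    (C := fun x => ∀ y, (tensorRecAux step x y).1 = x * y.1) ?_ ?_ ?_ ?_ x
  · intro r y
    simp [Algebra.smul_def]
  · intro c y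
    simp [tensorRecAux]
  · intro a b ha hb y
    simp [ha, hb, mul_assoc]
  · intro a b ha hb y
    simp [ha, hb, add_mul]

@[simp] theorem tensorRec_cons (c : W) (x : TensorAlgebra A W) :
    tensorRec m₀ step (letter c * x) = step c (x, tensorRec m₀ step x) := by
  have h := tensorRecAux_fst step x (1, m₀)
  rw [mul_one] at h
  have h2 : ∀ y, (tensorRecAux step (letter c) y).2 = step c y := by
    intro y
    simp [tensorRecAux]
  have h3 : tensorRecAux step x (1, m₀) = (x, tensorRec m₀ step x) := Prod.ext h rfl
  calc tensorRec m₀ step (letter c * x)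
      = (tensorRecAux step (letter c) (tensorRecAux step x (1, m₀))).2 := by
        simp [tensorRec]
    _ = _ := by rw [h2, h3]

end

theorem tensor_induction {p : TensorAlgebra A W → Prop} (one : p 1)
    (add : ∀ x y, p x → p y → p (x + y)) (smul : ∀ (a : A) x, p x → p (a • x))
    (cons : ∀ c x, p x → p (letter c * x)) (x : TensorAlgebra A W) : p x := by
  have key : ∀ y, p y → p (x * y) := by
    refine TensorAlgebra.induction (R := A) (M := W)
      (C := fun x => ∀ y, p y → p (x * y)) ?_ ?_ ?_ ?_ x
    · intro r y hy
      rw [← Algebra.smul_def]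
      exact smul r y hy
    · exact fun c y hy => cons c y hy
    · intro a b ha hb y hy
      rw [mul_assoc]
      exact ha _ (hb _ hy)
    · intro a b ha hb y hy
      rw [add_mul]
      exact add _ _ (ha _ hy) (hb _ hy)
  simpa using key 1 one

theorem tensor_hom_ext {M : Type*} [AddCommMonoid M] [Module A M]
    {f g : TensorAlgebra A W →ₗ[A] M} (h1 : f 1 = g 1)
    (hc : ∀ c x, f x = g x → f (letter c * x) = g (letter c * x)) : f = g := by
  refine LinearMap.ext fun x => ?_
  induction x using tensor_induction with
  | one => exact h1
  | add x y hx hy => rw [map_add, map_add, hx, hy]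
  | smul a x hx => rw [map_smul, map_smul, hx]
  | cons c x hx => exact hc c x hx

variable (A W) in
/-- The deconcatenation coproduct of `T(W)`,
`Δ(c₁|…|c_p) = ∑_{i=0}^p (c₁|…|c_i) ⊗ (c_{i+1}|…|c_p)`, where `c₁|…|c_p` is the product
`ι c₁ * … * ι c_p` in the tensor algebra. It is given by recursion on the first letter:
`Δ 1 = 1 ⊗ 1` and `Δ(c|x) = 1 ⊗ (c|x) + (c ⊗ 1) Δ(x)`. -/
def deconc : TensorAlgebra A W →ₗ[A] TensorAlgebra A W ⊗[A] TensorAlgebra A W :=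
  tensorRec (1 ⊗ₜ 1) <| LinearMap.mk₂ A
    (fun (c : W) (y : TensorAlgebra A W × (TensorAlgebra A W ⊗[A] TensorAlgebra A W)) =>
      (1 : TensorAlgebra A W) ⊗ₜ[A] (letter c * y.1) + (letter c ⊗ₜ[A] 1) * y.2)
    (fun c c' y => by simp [add_mul, TensorProduct.tmul_add, TensorProduct.add_tmul]; abel)
    (fun a c y => by simp [← TensorProduct.smul_tmul'])
    (fun c y y' => by simp [mul_add, TensorProduct.tmul_add]; abel)
    (fun a c y => by simp)

variable (A W) in
@[simp] theorem deconc_one : deconc A W 1 = 1 ⊗ₜ 1 := by simp [deconc]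

@[simp] theorem deconc_cons (c : W) (x : TensorAlgebra A W) :
    deconc A W (letter c * x) = 1 ⊗ₜ (letter c * x) + (letter c ⊗ₜ[A] 1) * deconc A W x := by
  simp [deconc]

variable (A W) in
/-- Split off the first letter: `1 ↦ 0` and `c|x ↦ c ⊗ x`. -/
def uncons : TensorAlgebra A W →ₗ[A] W ⊗[A] TensorAlgebra A W :=
  tensorRec 0 <| (LinearMap.lcomp A _ (LinearMap.fst A (TensorAlgebra A W)
    (W ⊗[A] TensorAlgebra A W))) ∘ₗ TensorProduct.mk A W (TensorAlgebra A W)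

variable (A W) in
@[simp] theorem uncons_one : uncons A W 1 = 0 := by simp [uncons]

@[simp] theorem uncons_cons (c : W) (x : TensorAlgebra A W) :
    uncons A W (letter c * x) = c ⊗ₜ x := by
  simp [uncons]

/-- Multiply a letter into the first letter of a tensor: `(c, c'|x) ↦ b(c,c')|x` and `(c, 1) ↦ 0`. -/
def absorb (b : W →ₗ[A] W →ₗ[A] W) : W →ₗ[A] TensorAlgebra A W →ₗ[A] TensorAlgebra A W :=
  (LinearMap.lcomp A (TensorAlgebra A W) (uncons A W)) ∘ₗ
    (TensorProduct.uncurry (.id A) W (TensorAlgebra A W) (TensorAlgebra A W)) ∘ₗ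
    (LinearMap.llcomp A W W (Module.End A (TensorAlgebra A W))
      (LinearMap.mul A (TensorAlgebra A W) ∘ₗ letter)) ∘ₗ b

@[simp] theorem absorb_one (b : W →ₗ[A] W →ₗ[A] W) (c : W) : absorb b c 1 = 0 := by
  simp [absorb]

@[simp] theorem absorb_cons (b : W →ₗ[A] W →ₗ[A] W) (c c' : W) (x : TensorAlgebra A W) :
    absorb b c (letter c' * x) = letter (b c c') * x := by
  simp [absorb]

/-- The differential `d₁ + d₂` of the bar construction on `T(W)`, where `W = s⁻¹C̄`, `δ` is the differential
of `C̄`, `μ` its product, and `σ` is multiplication by `(-1)^‖c‖` with `‖c‖ = |c| - 1` the degree of `c` in `W`.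
It is the recursive form (in the first letter) of the sum of
`d₁(c₁|…|c_p) = -∑_i (-1)^{‖c₁‖+…+‖c_{i-1}‖} c₁|…|δ c_i|…|c_p` and
`d₂(c₁|…|c_p) = -∑_i (-1)^{‖c₁‖+…+‖c_i‖} c₁|…|μ(c_i,c_{i+1})|…|c_p`, namely `d 1 = 0` and
`d(c|x) = -(δ c)|x - (-1)^‖c‖ (c·x) + (-1)^‖c‖ c|d x`, where `c·(c'|y) = μ(c,c')|y` and `c·1 = 0`. -/
def barDiff (δ σ : W →ₗ[A] W) (μ : W →ₗ[A] W →ₗ[A] W) : TensorAlgebra A W →ₗ[A] TensorAlgebra A W :=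
  tensorRec 0 <| LinearMap.mk₂ A
    (fun (c : W) (y : TensorAlgebra A W × TensorAlgebra A W) =>
      -(letter (δ c) * y.1) - absorb μ (σ c) y.1 + letter (σ c) * y.2)
    (fun c c' y => by simp [add_mul]; abel)
    (fun a c y => by simp [smul_sub])
    (fun c y y' => by simp [mul_add]; abel)
    (fun a c y => by simp [smul_sub])

section
variable (δ σ : W →ₗ[A] W) (μ : W →ₗ[A] W →ₗ[A] W)

@[simp] theorem barDiff_one : barDiff δ σ μ 1 = 0 := by simp [barDiff]

@[simp] theorem barDiff_cons (c : W) (x : TensorAlgebra A W) :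
    barDiff δ σ μ (letter c * x) =
      -(letter (δ c) * x) - absorb μ (σ c) x + letter (σ c) * barDiff δ σ μ x := by
  simp [barDiff]

end

/-- `T(W)` is functorial: `c₁|…|c_p ↦ f c₁|…|f c_p`. -/
def tensorMap {W' : Type*} [AddCommMonoid W'] [Module A W'] (f : W →ₗ[A] W') :
    TensorAlgebra A W →ₐ[A] TensorAlgebra A W' :=
  TensorAlgebra.lift A (TensorAlgebra.ι A ∘ₗ f)

@[simp] theorem tensorMap_letter {W' : Type*} [AddCommMonoid W'] [Module A W'] (f : W →ₗ[A] W') (c : W) :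
    tensorMap f (letter c) = TensorAlgebra.ι A (f c) := by
  simp [tensorMap]

theorem deconc_map {W' : Type*} [AddCommMonoid W'] [Module A W'] (f : W →ₗ[A] W')
    (x : TensorAlgebra A W) :
    deconc A W' (tensorMap f x) =
      TensorProduct.map (tensorMap f).toLinearMap (tensorMap f).toLinearMap (deconc A W x) := by
  refine LinearMap.congr_fun (f := deconc A W' ∘ₗ (tensorMap f).toLinearMap)
    (g := TensorProduct.map (tensorMap f).toLinearMap (tensorMap f).toLinearMap ∘ₗ deconc A W)
    (tensor_hom_ext ?_ ?_) x
  · simp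
  · intro c x hx
    simp only [LinearMap.comp_apply, AlgHom.toLinearMap_apply] at hx
    have hm (y : TensorAlgebra A W ⊗[A] TensorAlgebra A W) :
        TensorProduct.map (tensorMap f).toLinearMap (tensorMap f).toLinearMap
          ((letter c ⊗ₜ[A] 1) * y) = (letter (f c) ⊗ₜ[A] 1) *
          TensorProduct.map (tensorMap f).toLinearMap (tensorMap f).toLinearMap y := by
      induction y using TensorProduct.induction_on with
      | zero => simp
      | tmul a b => simp
      | add a b ha hb => simp only [mul_add, map_add, ha, hb]
    simp [hx, hm]

theorem absorb_map {W' : Type*} [AddCommMonoid W'] [Module A W'] (f : W →ₗ[A] W')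
    (μ : W →ₗ[A] W →ₗ[A] W) (μ' : W' →ₗ[A] W' →ₗ[A] W')
    (hμ : ∀ c c', μ' (f c) (f c') = f (μ c c')) (c : W) (x : TensorAlgebra A W) :
    absorb μ' (f c) (tensorMap f x) = tensorMap f (absorb μ c x) := by
  induction x using tensor_induction with
  | one => simp
  | add x y hx hy => simp only [map_add, hx, hy]
  | smul a x hx => simp only [map_smul, hx]
  | cons c x hx => simp [hμ]

theorem barDiff_map {W' : Type*} [AddCommMonoid W'] [Module A W'] (f : W →ₗ[A] W')
    (δ σ : W →ₗ[A] W) (μ : W →ₗ[A] W →ₗ[A] W) (δ' σ' : W' →ₗ[A] W') (μ' : W' →ₗ[A] W' →ₗ[A] W')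
    (hδ : ∀ c, δ' (f c) = f (δ c)) (hσ : ∀ c, σ' (f c) = f (σ c))
    (hμ : ∀ c c', μ' (f c) (f c') = f (μ c c')) (x : TensorAlgebra A W) :
    barDiff δ' σ' μ' (tensorMap f x) = tensorMap f (barDiff δ σ μ x) := by
  induction x using tensor_induction with
  | one => simp
  | add x y hx hy => simp only [map_add, hx, hy]
  | smul a x hx => simp only [map_smul, hx]
  | cons c x hx => simp [hδ, hσ, hx, absorb_map f μ μ' hμ]

theorem deconc_counit_left (x : TensorAlgebra A W) :
    LinearMap.rTensor _ (TensorAlgebra.algebraMapInv (R := A) (M := W)).toLinearMap (deconc A W x) = 1 ⊗ₜ x := by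
  induction x using tensor_induction with
  | one => simp
  | add x y hx hy => simp only [map_add, hx, hy, TensorProduct.tmul_add]
  | smul a x hx => simp only [map_smul, hx, TensorProduct.tmul_smul]
  | cons c x hx =>
    have hm (y : TensorAlgebra A W ⊗[A] TensorAlgebra A W) :
        LinearMap.rTensor _ (TensorAlgebra.algebraMapInv (R := A) (M := W)).toLinearMap
          ((letter c ⊗ₜ[A] 1) * y) = 0 := by
      induction y using TensorProduct.induction_on with
      | zero => simp
      | tmul a b => simp [TensorAlgebra.algebraMapInv]
      | add a b ha hb => simp only [mul_add, map_add, ha, hb, add_zero]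
    simp [hm]

theorem deconc_counit_right (x : TensorAlgebra A W) :
    LinearMap.lTensor _ (TensorAlgebra.algebraMapInv (R := A) (M := W)).toLinearMap (deconc A W x) = x ⊗ₜ 1 := by
  induction x using tensor_induction with
  | one => simp
  | add x y hx hy => simp only [map_add, hx, hy, TensorProduct.add_tmul]
  | smul a x hx => simp only [map_smul, hx, TensorProduct.smul_tmul']
  | cons c x hx =>
    have hm (y : TensorAlgebra A W ⊗[A] TensorAlgebra A W) :
        LinearMap.lTensor _ (TensorAlgebra.algebraMapInv (R := A) (M := W)).toLinearMap
          ((letter c ⊗ₜ[A] 1) * y) = LinearMap.rTensor _ (LinearMap.mulLeft A (letter c)) 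
        (LinearMap.lTensor _ (TensorAlgebra.algebraMapInv (R := A) (M := W)).toLinearMap y) := by
      induction y using TensorProduct.induction_on with
      | zero => simp
      | tmul a b => simp 
      | add a b ha hb => simp only [mul_add, map_add, ha, hb]
    simp [hm, hx]
    simp [TensorAlgebra.algebraMapInv]

theorem deconc_coassoc (x : TensorAlgebra A W) :
    TensorProduct.assoc A _ _ _ (LinearMap.rTensor _ (deconc A W) (deconc A W x)) =
      LinearMap.lTensor _ (deconc A W) (deconc A W x) := by
  induction x using tensor_induction with
  | one => simp
  | add x y hx hy => simp only [map_add, hx, hy]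
  | smul a x hx => simp only [map_smul, hx]
  | cons c x hx =>
    have h1 (y : TensorAlgebra A W ⊗[A] TensorAlgebra A W) :
        TensorProduct.assoc A _ _ _ (LinearMap.rTensor _ (deconc A W) ((letter c ⊗ₜ[A] 1) * y)) =
        1 ⊗ₜ ((letter c ⊗ₜ[A] 1) * y) +
        LinearMap.rTensor _ (LinearMap.mulLeft A (letter c))
         (TensorProduct.assoc A _ _ _ (LinearMap.rTensor _ (deconc A W) y)) := by
      induction y using TensorProduct.induction_on with
      | zero => simp
      | tmul a b => 
        simp [TensorProduct.add_tmul]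
        generalize deconc A W a = z
        induction z using TensorProduct.induction_on with
        | zero => simp
        | tmul a b => simp
        | add a b ha hb => simp only [mul_add, map_add, ha, hb, TensorProduct.add_tmul]
      | add a b ha hb => simp only [mul_add, map_add, ha, hb, TensorProduct.tmul_add]; abel
    have h2 (y : TensorAlgebra A W ⊗[A] TensorAlgebra A W) :
        (LinearMap.lTensor _ (deconc A W) ((letter c ⊗ₜ[A] 1) * y)) =
        LinearMap.rTensor _ (LinearMap.mulLeft A (letter c))
         (LinearMap.lTensor _ (deconc A W) y) := by
      induction y using TensorProduct.induction_on with
      | zero => simp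
      | tmul a b => simp
      | add a b ha hb => simp only [mul_add, map_add, ha, hb]
    simp [h1, h2, hx, TensorProduct.tmul_add, add_assoc]

/-- The bar differential is a coderivation. -/
theorem deconc_barDiff (δ σ : W →ₗ[A] W) (μ : W →ₗ[A] W →ₗ[A] W) (x : TensorAlgebra A W) :
    deconc A W (barDiff δ σ μ x) =
      LinearMap.rTensor _ (barDiff δ σ μ) (deconc A W x) +
      TensorProduct.map (tensorMap σ).toLinearMap (barDiff δ σ μ) (deconc A W x) := by
  have h1 (f : W →ₗ[A] W) (g : TensorAlgebra A W →ₗ[A] TensorAlgebra A W) (c : W)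
      (y : TensorAlgebra A W ⊗[A] TensorAlgebra A W) :
      TensorProduct.map (tensorMap f).toLinearMap g ((letter c ⊗ₜ[A] 1) * y) =
      (letter (f c) ⊗ₜ[A] 1) * TensorProduct.map (tensorMap f).toLinearMap g y := by
    induction y using TensorProduct.induction_on with
    | zero => simp
    | tmul a b => simp
    | add a b ha hb => simp only [mul_add, map_add, ha, hb]
  have h2 (c : W) (y : TensorAlgebra A W ⊗[A] TensorAlgebra A W) :
      LinearMap.rTensor _ (barDiff δ σ μ) ((letter c ⊗ₜ[A] 1) * y) =
      -((letter (δ c) ⊗ₜ[A] 1) * y) - LinearMap.rTensor _ (absorb μ (σ c)) y +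
        (letter (σ c) ⊗ₜ[A] 1) * LinearMap.rTensor _ (barDiff δ σ μ) y := by
    induction y using TensorProduct.induction_on with
    | zero => simp
    | tmul a b => simp [TensorProduct.add_tmul, TensorProduct.sub_tmul, TensorProduct.neg_tmul]
    | add a b ha hb => simp only [mul_add, map_add, ha, hb]; abel
  have h3 (c : W) (x : TensorAlgebra A W) : deconc A W (absorb μ c x) =
      1 ⊗ₜ absorb μ c x + LinearMap.rTensor _ (absorb μ c) (deconc A W x) := by
    induction x using tensor_induction with
    | one => simp
    | add x y hx hy => simp only [map_add, hx, hy, TensorProduct.tmul_add]; abel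
    | smul a x hx => simp only [map_smul, hx, TensorProduct.tmul_smul, smul_add]
    | cons c' x hx =>
      have (y : TensorAlgebra A W ⊗[A] TensorAlgebra A W) :
          LinearMap.rTensor _ (absorb μ c) ((letter c' ⊗ₜ[A] 1) * y) =
          (letter (μ c c') ⊗ₜ[A] 1) * y := by
        induction y using TensorProduct.induction_on with
        | zero => simp
        | tmul a b => simp
        | add a b ha hb => simp only [mul_add, map_add, ha, hb]
      simp [this]
  induction x using tensor_induction with
  | one => simp
  | add x y hx hy => simp only [map_add, hx, hy]; abel
  | smul a x hx => simp only [map_smul, hx, smul_add]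
  | cons c x hx =>
    simp [h1, h2, h3, hx, mul_add, TensorProduct.tmul_add, TensorProduct.tmul_sub,
      TensorProduct.tmul_neg]
    abel

instance [IsDomain A] [IsPrincipalIdealRing A] [Module.Flat A W] (n : ℕ) : Module.Flat A (⨂[A]^n W) := by
  induction n with
  | zero => exact Module.Flat.of_linearEquiv (PiTensorProduct.isEmptyEquiv (R := A) (s := fun _ : Fin 0 => W) (Fin 0))
  | succ n ih =>
    have : Module.Flat A (⨂[A]^1 W) := Module.Flat.of_linearEquiv
      (PiTensorProduct.subsingletonEquiv (R := A) (s := fun _ : Fin 1 => W) (0 : Fin 1))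
    exact Module.Flat.of_linearEquiv (TensorPower.mulEquiv (R := A) (M := W) (n := n) (m := 1)).symm

instance flat_tensorAlgebra [IsDomain A] [IsPrincipalIdealRing A] [Module.Flat A W] :
    Module.Flat A (TensorAlgebra A W) :=
  Module.Flat.of_linearEquiv (TensorAlgebra.equivDirectSum (R := A) (M := W)).toLinearEquiv

end Tensor

section Sub
universe u v w
variable {A : Type u} [CommRing A] {T : Type v} [AddCommGroup T] [Module A T]
  {K : Type w} [AddCommGroup K] [Module A K] (i : K →ₗ[A] T)

theorem mem_range_map_of_exact [Module.Flat A T] {T' : Type*} [AddCommGroup T'] [Module A T']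
    (F : T →ₗ[A] T') [Module.Flat A K] [Module.Flat A T'] (hi : Function.Injective i)
    (ex : Function.Exact i F) (z : T ⊗[A] T)
    (hl : LinearMap.rTensor T F z = 0) (hr : LinearMap.lTensor T F z = 0) :
    z ∈ LinearMap.range (TensorProduct.map i i) := by
  obtain ⟨y, rfl⟩ := (Module.Flat.rTensor_exact T ex z).1 hl
  have hy : LinearMap.lTensor K F y = 0 := by
    apply Module.Flat.rTensor_preserves_injective_linearMap (M := T') i hi
    rw [map_zero, ← LinearMap.comp_apply, LinearMap.rTensor_comp_lTensor,
      ← LinearMap.lTensor_comp_rTensor]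
    exact hr
  obtain ⟨x, rfl⟩ := (Module.Flat.lTensor_exact K ex y).1 hy
  refine ⟨x, ?_⟩
  rw [← LinearMap.comp_apply, LinearMap.rTensor_comp_lTensor]

variable (D : T →ₗ[A] T ⊗[A] T)

/-- The restriction of `D : T → T ⊗ T` along an injection `i : K → T` to a map `K → K ⊗ K`, when `D` maps the
image of `K` into the image of `K ⊗ K`. -/
def subComul (hinj : Function.Injective (TensorProduct.map i i))
    (hD : ∀ x, D (i x) ∈ LinearMap.range (TensorProduct.map i i)) : K →ₗ[A] K ⊗[A] K :=
  (LinearEquiv.ofInjective (TensorProduct.map i i) hinj).symm.toLinearMap ∘ₗ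
    LinearMap.codRestrict _ (D ∘ₗ i) hD

theorem map_subComul (hinj : Function.Injective (TensorProduct.map i i))
    (hD : ∀ x, D (i x) ∈ LinearMap.range (TensorProduct.map i i)) (x : K) :
    TensorProduct.map i i (subComul i D hinj hD x) = D (i x) := by
  have := congrArg Subtype.val ((LinearEquiv.ofInjective (TensorProduct.map i i) hinj).apply_symm_apply
    (LinearMap.codRestrict _ (D ∘ₗ i) hD x))
  simp only [subComul, LinearMap.comp_apply]
  exact this

/-- The coalgebra structure that a submodule stable under a coproduct inherits. -/
abbrev subCoalgebra [Module.Flat A T] [Module.Flat A K] (hi : Function.Injective i) (e : T →ₗ[A] A)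
    (hD : ∀ x, D (i x) ∈ LinearMap.range (TensorProduct.map i i))
    (hel : ∀ x, LinearMap.rTensor T e (D x) = 1 ⊗ₜ x)
    (her : ∀ x, LinearMap.lTensor T e (D x) = x ⊗ₜ 1)
    (hco : ∀ x, TensorProduct.assoc A _ _ _ (LinearMap.rTensor T D (D x)) = LinearMap.lTensor T D (D x)) :
    Coalgebra A K :=
  have hinj : Function.Injective (TensorProduct.map i i) :=
    TensorProduct.map_injective_of_flat_flat _ _ hi hi
  { comul := subComul i D hinj hD
    counit := e ∘ₗ i
    coassoc := by
      have hinj3 : Function.Injective (TensorProduct.map i (TensorProduct.map i i)) :=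
        TensorProduct.map_injective_of_flat_flat _ _ hi hinj
      refine LinearMap.ext fun x => hinj3 ?_
      have h1 (z : K ⊗[A] K) : TensorProduct.map i (TensorProduct.map i i)
          (LinearMap.lTensor K (subComul i D hinj hD) z) =
          LinearMap.lTensor T D (TensorProduct.map i i z) := by
        induction z using TensorProduct.induction_on with
        | zero => simp
        | tmul a b => simp [← map_subComul i D hinj hD]
        | add a b ha hb => simp only [map_add, ha, hb]
      have h2 (z : (K ⊗[A] K) ⊗[A] K) : TensorProduct.map i (TensorProduct.map i i)
          (TensorProduct.assoc A K K K z) =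
          TensorProduct.assoc A T T T (TensorProduct.map (TensorProduct.map i i) i z) := by
        refine LinearMap.congr_fun (f := TensorProduct.map i (TensorProduct.map i i) ∘ₗ
          (TensorProduct.assoc A K K K).toLinearMap) (g := (TensorProduct.assoc A T T T).toLinearMap ∘ₗ
          TensorProduct.map (TensorProduct.map i i) i) ?_ z
        ext a b c
        simp
      have h3 (z : K ⊗[A] K) : TensorProduct.map (TensorProduct.map i i) i
          (LinearMap.rTensor K (subComul i D hinj hD) z) =
          LinearMap.rTensor T D (TensorProduct.map i i z) := by
        induction z using TensorProduct.induction_on with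
        | zero => simp
        | tmul a b => simp [← map_subComul i D hinj hD]
        | add a b ha hb => simp only [map_add, ha, hb]
      simp only [LinearMap.comp_apply, LinearEquiv.coe_coe]
      rw [h1, h2, h3, map_subComul, hco]
    rTensor_counit_comp_comul := by
      have hi' : Function.Injective (LinearMap.lTensor A i) :=
        Module.Flat.lTensor_preserves_injective_linearMap _ hi
      refine LinearMap.ext fun x => hi' ?_
      have h (z : K ⊗[A] K) : LinearMap.lTensor A i (LinearMap.rTensor K (e ∘ₗ i) z) =
          LinearMap.rTensor T e (TensorProduct.map i i z) := by
        induction z using TensorProduct.induction_on with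
        | zero => simp
        | tmul a b => simp
        | add a b ha hb => simp only [map_add, ha, hb]
      simp only [LinearMap.comp_apply]
      rw [h, map_subComul, hel]
      simp
    lTensor_counit_comp_comul := by
      have hi' : Function.Injective (LinearMap.rTensor A i) :=
        Module.Flat.rTensor_preserves_injective_linearMap _ hi
      refine LinearMap.ext fun x => hi' ?_
      have h (z : K ⊗[A] K) : LinearMap.rTensor A i (LinearMap.lTensor K (e ∘ₗ i) z) =
          LinearMap.lTensor T e (TensorProduct.map i i z) := by
        induction z using TensorProduct.induction_on with
        | zero => simp
        | tmul a b => simp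
        | add a b ha hb => simp only [map_add, ha, hb]
      simp only [LinearMap.comp_apply]
      rw [h, map_subComul, her]
      simp }
end Sub

section DegZero
universe u v
variable {A : Type u} [CommRing A] {W : Type v} [AddCommMonoid W] [Module A W]
  (δ σ p : W →ₗ[A] W) (μ : W →ₗ[A] W →ₗ[A] W)

theorem tensorMap_proj_barDiff (hδ : ∀ c, p (δ c) = 0) (hμ : ∀ c c', p (μ c c') = 0)
    (x : TensorAlgebra A W) : tensorMap p (barDiff δ σ μ x) = 0 := by
  have h (c : W) (x : TensorAlgebra A W) : tensorMap p (absorb μ c x) = 0 := by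
    induction x using tensor_induction with
    | one => simp
    | add x y hx hy => simp only [map_add, hx, hy, add_zero]
    | smul a x hx => simp only [map_smul, hx, smul_zero]
    | cons c x hx => simp [hμ]
  induction x using tensor_induction with
  | one => simp
  | add x y hx hy => simp only [map_add, hx, hy, add_zero]
  | smul a x hx => simp only [map_smul, hx, smul_zero]
  | cons c x hx => simp [hδ, hx, h]

/-- A map whose kernel is the set of cocycles of degree zero. -/
def cocycleMap : TensorAlgebra A W →ₗ[A] TensorAlgebra A W × TensorAlgebra A W :=
  (barDiff δ σ μ).prod (LinearMap.id - (tensorMap p).toLinearMap)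

theorem deconc_cocycle [IsDomain A] [IsPrincipalIdealRing A] [Module.Flat A W]
    (hδ : ∀ c, p (δ c) = 0) (hμ : ∀ c c', p (μ c c') = 0) (hσ : ∀ c, p (σ c) = p c)
    (hp : ∀ c, p (p c) = p c)
    (x : TensorAlgebra A W) (hd : barDiff δ σ μ x = 0) (hx : tensorMap p x = x) :
    LinearMap.rTensor _ (cocycleMap δ σ p μ) (deconc A W x) = 0 ∧
    LinearMap.lTensor _ (cocycleMap δ σ p μ) (deconc A W x) = 0 := by
  let T := TensorAlgebra A W
  let E : T →ₗ[A] T := (tensorMap p).toLinearMap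
  let d : T →ₗ[A] T := barDiff δ σ μ
  let S : T →ₗ[A] T := (tensorMap σ).toLinearMap
  have hΔ : TensorProduct.map E E (deconc A W x) = deconc A W x := by
    have := deconc_map p x
    rw [hx] at this
    exact this.symm
  have tc (f g h : W →ₗ[A] W) (hf : ∀ c, f (g c) = h c) :
      (tensorMap f).toLinearMap ∘ₗ (tensorMap g).toLinearMap = (tensorMap h).toLinearMap := by
    rw [← AlgHom.comp_toLinearMap]
    congr 1
    ext c
    simp [hf]
  have EE : E ∘ₗ E = E := tc _ _ _ hp
  have ES : E ∘ₗ S = E := tc _ _ _ hσ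
  have Ed : E ∘ₗ d = 0 := LinearMap.ext fun x => tensorMap_proj_barDiff δ σ p μ hδ hμ x
  have hcod := deconc_barDiff δ σ μ x
  rw [hd, map_zero] at hcod
  have e1 : LinearMap.lTensor T d (deconc A W x) = 0 := by
    have := congrArg (LinearMap.rTensor T E) hcod
    have r1 (z : T ⊗[A] T) : LinearMap.rTensor T E (LinearMap.rTensor T d z) = 0 := by
      rw [← LinearMap.comp_apply, ← LinearMap.rTensor_comp, Ed, LinearMap.rTensor_zero,
        LinearMap.zero_apply]
    have r2 (z : T ⊗[A] T) : LinearMap.rTensor T E (TensorProduct.map S d z) =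
        TensorProduct.map E d z := by
      rw [← LinearMap.comp_apply, LinearMap.rTensor_comp_map, ES]
    rw [map_zero, map_add] at this
    erw [r1, r2] at this
    rw [zero_add] at this
    have r3 (z : T ⊗[A] T) : TensorProduct.map E d (TensorProduct.map E E z) =
        LinearMap.lTensor T d (TensorProduct.map E E z) := by
      rw [← LinearMap.comp_apply, ← LinearMap.comp_apply, LinearMap.lTensor_comp_map,
        ← TensorProduct.map_comp, EE]
    have r4 := r3 (deconc A W x)
    rw [hΔ] at r4
    exact r4.symm.trans this.symm
  have e2 : LinearMap.rTensor T d (deconc A W x) = 0 := by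
    have h : TensorProduct.map S d (deconc A W x) = 0 := by
      rw [← LinearMap.rTensor_comp_lTensor, LinearMap.comp_apply, e1, map_zero]
    rw [h, add_zero] at hcod
    exact hcod.symm
  have e3 : LinearMap.rTensor T E (deconc A W x) = deconc A W x := by
    conv_lhs => rw [← hΔ]
    rw [← LinearMap.comp_apply, LinearMap.rTensor_comp_map, EE, hΔ]
  have e4 : LinearMap.lTensor T E (deconc A W x) = deconc A W x := by
    conv_lhs => rw [← hΔ]
    rw [← LinearMap.comp_apply, LinearMap.lTensor_comp_map, EE, hΔ]
  have hF : cocycleMap δ σ p μ = LinearMap.inl A T T ∘ₗ d + LinearMap.inr A T T ∘ₗ (LinearMap.id - E) := by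
    ext y <;> simp [cocycleMap, d, E]
  rw [hF]
  constructor
  · rw [LinearMap.rTensor_add, LinearMap.add_apply, LinearMap.rTensor_comp, LinearMap.rTensor_comp,
      LinearMap.comp_apply, LinearMap.comp_apply, e2, LinearMap.rTensor_sub, LinearMap.sub_apply, e3]
    simp
  · rw [LinearMap.lTensor_add, LinearMap.add_apply, LinearMap.lTensor_comp, LinearMap.lTensor_comp,
      LinearMap.comp_apply, LinearMap.comp_apply, e1, LinearMap.lTensor_sub, LinearMap.sub_apply, e4]
    simp
end DegZero

section Cochains
universe u v
variable (Γ : Type u) [Group Γ] (A : Type v) [CommRing A]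

/-- The `n`-cochains of the simplicial set `BΓ` with coefficients in `A`: the set of `n`-simplices of `BΓ`
is `Γⁿ`, a simplex is degenerate iff one of its entries is the unit, and normalized cochains are
functions that vanish on the degenerate simplices. -/
def cochains (n : ℕ) : Submodule A ((Fin n → Γ) → A) where
  carrier := {f | ∀ g, (∃ i, g i = 1) → f g = 0}
  add_mem' := fun {f f'} hf hf' g hg => by simp [hf g hg, hf' g hg]
  zero_mem' := fun g _ => rfl
  smul_mem' := fun a f hf g hg => by simp [hf g hg]

variable {Γ A}

/-- The simplicial coboundary `f ↦ ∑_{i=0}^{n+1} (-1)^i f ∘ ∂_i`: the face `∂_0` drops the first entry, and the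
face `∂_{j+1}` multiplies the entries `j` and `j+1`, the last face dropping the last entry. -/
def coboundaryFun {n : ℕ} (f : (Fin n → Γ) → A) (g : Fin (n + 1) → Γ) : A :=
  f (fun i => g i.succ) + ∑ j : Fin (n + 1), (-1) ^ ((j : ℕ) + 1) * f (Fin.contractNth j (· * ·) g)

theorem contractNth_castSucc_eq {n : ℕ} (k : Fin n) (g : Fin (n + 1) → Γ) (hg : g k.succ = 1) :
    Fin.contractNth k.castSucc (· * ·) g = Fin.contractNth k.succ (· * ·) g := by
  funext i
  rcases lt_trichotomy (i : ℕ) (k : ℕ) with h | h | h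
  · rw [Fin.contractNth_apply_of_lt _ _ _ _ (by simpa using h),
      Fin.contractNth_apply_of_lt _ _ _ _ (by simp; omega)]
  · rw [Fin.contractNth_apply_of_eq _ _ _ _ (by simpa using h),
      Fin.contractNth_apply_of_lt _ _ _ _ (by simp; omega)]
    have : i = k := Fin.ext h
    subst this
    rw [hg, mul_one]
  · rw [Fin.contractNth_apply_of_gt _ _ _ _ (by simpa using h)]
    rcases Nat.lt_or_ge (k + 1) i with h' | h'
    · rw [Fin.contractNth_apply_of_gt _ _ _ _ (by simpa using h')]
    · rw [Fin.contractNth_apply_of_eq _ _ _ _ (by simp; omega)]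
      have : i.castSucc = k.succ := Fin.ext (by simp; omega)
      rw [this, hg, one_mul]

theorem exists_contractNth_eq_one {n : ℕ} (j k : Fin (n + 1)) (g : Fin (n + 1) → Γ) (hg : g k = 1)
    (h : (k : ℕ) < j ∨ (j : ℕ) + 1 < k) : ∃ i, Fin.contractNth j (· * ·) g i = 1 := by
  rcases h with h | h
  · refine ⟨⟨k, by omega⟩, ?_⟩
    rw [Fin.contractNth_apply_of_lt _ _ _ _ (by simpa using h)]
    exact hg
  · refine ⟨⟨k - 1, by omega⟩, ?_⟩
    rw [Fin.contractNth_apply_of_gt _ _ _ _ (by simp; omega)]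
    rw [← hg]
    congr 1
    exact Fin.ext (by simp; omega)

theorem coboundaryFun_mem {n : ℕ} {f : (Fin n → Γ) → A} (hf : f ∈ cochains Γ A n) :
    coboundaryFun f ∈ cochains Γ A (n + 1) := by
  rintro g ⟨k, hk⟩
  unfold coboundaryFun
  induction k using Fin.cases with
  | zero =>
    rw [Fin.sum_univ_succ, Finset.sum_eq_zero]
    · have : Fin.contractNth 0 (· * ·) g = fun i => g i.succ := by
        funext i
        rcases Nat.eq_zero_or_pos (i : ℕ) with h | h
        · rw [Fin.contractNth_apply_of_eq _ _ _ _ (by simpa using h)]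
          have : i.castSucc = 0 := Fin.ext (by simpa using h)
          rw [this, hk, one_mul]
        · rw [Fin.contractNth_apply_of_gt _ _ _ _ (by simpa using h)]
      rw [this]
      simp
    · intro j _
      rw [hf _ (exists_contractNth_eq_one _ 0 g hk (Or.inl (by simp))), mul_zero]
  | succ k =>
    rw [hf (fun i => g i.succ) ⟨k, hk⟩, zero_add,
      Finset.sum_eq_add k.castSucc k.succ (by simp [Fin.ext_iff])]
    · rw [contractNth_castSucc_eq k g hk]
      simp [pow_succ]
    · intro j _ hj
      rw [hf _ (exists_contractNth_eq_one _ k.succ g hk ?_), mul_zero]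
      simp only [ne_eq, Fin.ext_iff, Fin.val_castSucc, Fin.val_succ] at hj ⊢
      omega
    · simp
    · simp

variable (Γ A) in
/-- The differential `Cⁿ(BΓ;A) → Cⁿ⁺¹(BΓ;A)` of the normalized cochain complex. -/
def coboundary (n : ℕ) : cochains Γ A n →ₗ[A] cochains Γ A (n + 1) where
  toFun f := ⟨coboundaryFun f.1, coboundaryFun_mem f.2⟩
  map_add' f f' := by
    ext g
    simp [coboundaryFun, mul_add, Finset.sum_add_distrib]
    ring
  map_smul' a f := by
    ext g
    simp [coboundaryFun, mul_add, Finset.mul_sum, mul_left_comm]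

variable (Γ A) in
/-- The cup product `Cᵐ ⊗ Cⁿ → Cᵏ`, `k = m + n`:
`(f ⌣ f')(g₁,…,g_k) = f(g₁,…,g_m) f'(g_{m+1},…,g_k)`. -/
def cup (m n k : ℕ) (h : m + n = k) : cochains Γ A m →ₗ[A] cochains Γ A n →ₗ[A] cochains Γ A k :=
  LinearMap.mk₂ A
    (fun f f' => ⟨fun g => f.1 (fun i => g (i.castLE (h ▸ Nat.le_add_right m n))) *
        f'.1 (fun i => g (Fin.cast h (Fin.natAdd m i))), by
      rintro g ⟨i, hi⟩
      rcases Nat.lt_or_ge i m with him | him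
      · simp only
        rw [f.2 _ ⟨⟨i, him⟩, hi⟩, zero_mul]
      · simp only
        rw [f'.2 _ ⟨⟨i - m, by omega⟩, ?_⟩, mul_zero]
        rw [← hi]
        congr 1
        exact Fin.ext (by simp; omega)⟩)
    (fun f f₂ f' => by ext g; simp [add_mul])
    (fun a f f' => by ext g; simp [mul_assoc])
    (fun f f' f₂ => by ext g; simp [mul_add])
    (fun a f f' => by ext g; simp [mul_left_comm])

/-- Pullback of cochains along `Bh : BΓ → BΓ'`. -/
def cochainsMap {Γ' : Type*} [Group Γ'] (h : Γ →* Γ') (n : ℕ) : cochains Γ' A n →ₗ[A] cochains Γ A n where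
  toFun f := ⟨fun g => f.1 (fun i => h (g i)), fun g ⟨i, hi⟩ => f.2 _ ⟨i, by simp [hi]⟩⟩
  map_add' f f' := by ext g; simp
  map_smul' a f := by ext g; simp

variable (Γ A) in
/-- The desuspension `s⁻¹C̄` of the augmentation ideal of `C = C^*(BΓ;A)`. The augmentation is evaluation at
the only vertex of `BΓ`, so `C̄` is the sum of the `Cⁿ⁺¹` with `n ≥ 0`, and the summand `Cⁿ⁺¹` has degree `n` in
`s⁻¹C̄`. -/
abbrev Letters : Type (max u v) := ⨁ n : ℕ, cochains Γ A (n + 1)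

variable (Γ A) in
/-- The cochain differential on `s⁻¹C̄` (without sign). -/
def lettersD : Letters Γ A →ₗ[A] Letters Γ A :=
  DirectSum.toModule A ℕ _ fun n =>
    DirectSum.lof A ℕ (fun n => cochains Γ A (n + 1)) (n + 1) ∘ₗ coboundary Γ A (n + 1)

variable (Γ A) in
/-- Multiplication by `(-1)^n` on the part of degree `n` of `s⁻¹C̄`. -/
def lettersSign : Letters Γ A →ₗ[A] Letters Γ A :=
  DirectSum.toModule A ℕ _ fun n => (-1 : A) ^ n • DirectSum.lof A ℕ (fun n => cochains Γ A (n + 1)) n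

variable (Γ A) in
/-- The cup product on `C̄`; in the degrees of `s⁻¹C̄` it maps `(m, n)` to `m + n + 1`. -/
def lettersCup : Letters Γ A →ₗ[A] Letters Γ A →ₗ[A] Letters Γ A :=
  DirectSum.toModule A ℕ _ fun m => LinearMap.flip <|
    DirectSum.toModule A ℕ _ fun n => LinearMap.flip <|
      (cup Γ A (m + 1) (n + 1) (m + n + 1 + 1) (by omega)).compr₂
        (DirectSum.lof A ℕ (fun n => cochains Γ A (n + 1)) (m + n + 1))

/-- Pullback along `Bh : BΓ → BΓ'` on `s⁻¹C̄`. -/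
def lettersMap {Γ' : Type*} [Group Γ'] (h : Γ →* Γ') : Letters Γ' A →ₗ[A] Letters Γ A :=
  DirectSum.toModule A ℕ _ fun n =>
    DirectSum.lof A ℕ (fun n => cochains Γ A (n + 1)) n ∘ₗ cochainsMap h (n + 1)

variable (Γ A) in
/-- The projection of `s⁻¹C̄` to its part of degree `0`. -/
def lettersProj : Letters Γ A →ₗ[A] Letters Γ A :=
  DirectSum.lof A ℕ (fun n => cochains Γ A (n + 1)) 0 ∘ₗ
    DirectSum.component A ℕ (fun n => cochains Γ A (n + 1)) 0

variable (Γ A) in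
/-- The underlying module `⨁_p (s⁻¹C̄)^{⊗p}` of the bar construction `Bar(Γ;A)`. -/
abbrev Bar : Type (max u v) := TensorAlgebra A (Letters Γ A)

variable (Γ A) in
/-- The differential of the bar construction `Bar(Γ;A)`. -/
def barD : Bar Γ A →ₗ[A] Bar Γ A := barDiff (lettersD Γ A) (lettersSign Γ A) (lettersCup Γ A)

variable (Γ A) in
/-- The part of degree `q` of `Bar(Γ;A)`: the span of the `c₁|…|c_p` with `c_i` homogeneous of total degree `q`. -/
def barDegree (q : ℕ) : Submodule A (Bar Γ A) :=
  Submodule.span A {x | ∃ l : List (Σ n : ℕ, cochains Γ A (n + 1)),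
    (l.map Sigma.fst).sum = q ∧
    x = (l.map fun c => TensorAlgebra.ι A (DirectSum.lof A ℕ (fun n => cochains Γ A (n + 1)) c.1 c.2)).prod}

variable (Γ A) in
/-- The cocycles of degree zero of `Bar(Γ;A)`. -/
def barCocycles : Submodule A (Bar Γ A) := barDegree Γ A 0 ⊓ LinearMap.ker (barD Γ A)

variable (Γ A) in
/-- `H⁰_Bar(Γ;A)`, the cohomology of `Bar(Γ;A)` in degree zero. All letters have degree `≥ 0`, so `Bar(Γ;A)`
vanishes in degree `-1`, there are no coboundaries, and `H⁰` is the module of cocycles of degree zero. -/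
def H0Bar : Type (max u v) := barCocycles Γ A

instance : AddCommGroup (H0Bar Γ A) := inferInstanceAs (AddCommGroup (barCocycles Γ A))

instance : Module A (H0Bar Γ A) := inferInstanceAs (Module A (barCocycles Γ A))

/-- The inclusion of the cocycles into `Bar(Γ;A)`. -/
def H0Bar.incl : H0Bar Γ A →ₗ[A] Bar Γ A := (barCocycles Γ A).subtype

theorem H0Bar.incl_injective : Function.Injective (H0Bar.incl (Γ := Γ) (A := A)) :=
  (barCocycles Γ A).subtype_injective

theorem letters_hom_ext {M : Type*} [AddCommMonoid M] [Module A M] {f g : Letters Γ A →ₗ[A] M}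
    (h : ∀ n c, f (DirectSum.lof A ℕ (fun n => cochains Γ A (n + 1)) n c) =
      g (DirectSum.lof A ℕ (fun n => cochains Γ A (n + 1)) n c)) (x : Letters Γ A) : f x = g x := by
  refine LinearMap.congr_fun (DirectSum.linearMap_ext A fun n => LinearMap.ext fun c => ?_) x
  exact h n c

theorem lettersProj_lof_zero (c : cochains Γ A (0 + 1)) :
    lettersProj Γ A (DirectSum.lof A ℕ (fun n => cochains Γ A (n + 1)) 0 c) =
      DirectSum.lof A ℕ (fun n => cochains Γ A (n + 1)) 0 c := by
  simp [lettersProj, DirectSum.component.lof_self]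

theorem lettersProj_lof_succ (n : ℕ) (c : cochains Γ A (n + 1 + 1)) :
    lettersProj Γ A (DirectSum.lof A ℕ (fun n => cochains Γ A (n + 1)) (n + 1) c) = 0 := by
  simp [lettersProj, DirectSum.component.of]

theorem lettersProj_proj (x : Letters Γ A) : lettersProj Γ A (lettersProj Γ A x) = lettersProj Γ A x := by
  simp [lettersProj, DirectSum.component.lof_self]

theorem lettersProj_D (x : Letters Γ A) : lettersProj Γ A (lettersD Γ A x) = 0 := by
  refine letters_hom_ext (f := lettersProj Γ A ∘ₗ lettersD Γ A) (g := 0) (fun n c => ?_) x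
  simp [lettersD, lettersProj_lof_succ]

theorem lettersProj_sign (x : Letters Γ A) : lettersProj Γ A (lettersSign Γ A x) = lettersProj Γ A x := by
  refine letters_hom_ext (f := lettersProj Γ A ∘ₗ lettersSign Γ A) (g := lettersProj Γ A) (fun n c => ?_) x
  cases n with
  | zero => simp [lettersSign]
  | succ n => simp [lettersSign, lettersProj_lof_succ]

theorem lettersProj_cup (x y : Letters Γ A) : lettersProj Γ A (lettersCup Γ A x y) = 0 := by
  refine letters_hom_ext (f := (lettersProj Γ A) ∘ₗ (lettersCup Γ A).flip y) (g := 0) (fun n c => ?_) x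
  refine letters_hom_ext (f := (lettersProj Γ A) ∘ₗ lettersCup Γ A
    (DirectSum.lof A ℕ (fun n => cochains Γ A (n + 1)) n c)) (g := 0) (fun m c' => ?_) y
  simp [lettersCup, lettersProj_lof_succ]

theorem mem_barDegree_zero (x : Bar Γ A) : x ∈ barDegree Γ A 0 ↔ tensorMap (lettersProj Γ A) x = x := by
  constructor
  · intro hx
    induction hx using Submodule.span_induction with
    | mem x hx =>
      obtain ⟨l, hl, rfl⟩ := hx
      rw [map_list_prod, List.map_map]
      congr 1
      refine List.map_congr_left fun c hc => ?_
      have h0 : c.1 = 0 := List.sum_eq_zero_iff.1 hl c.1 (List.mem_map_of_mem hc)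
      obtain ⟨n, c⟩ := c
      subst h0
      simp [lettersProj_lof_zero]
    | zero => simp
    | add x y _ _ hx hy => rw [map_add, hx, hy]
    | smul a x _ hx => rw [map_smul, hx]
  · intro hx
    rw [← hx]
    clear hx
    induction x using tensor_induction with
    | one => exact Submodule.subset_span ⟨[], by simp, by simp⟩
    | add x y hx hy => rw [map_add]; exact add_mem hx hy
    | smul a x hx => rw [map_smul]; exact Submodule.smul_mem _ _ hx
    | cons c x hx =>
      rw [map_mul, tensorMap_letter]
      generalize tensorMap (lettersProj Γ A) x = y at hx
      induction hx using Submodule.span_induction with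
      | mem x hx =>
        obtain ⟨l, hl, rfl⟩ := hx
        refine Submodule.subset_span ⟨⟨0, DirectSum.component A ℕ (fun n => cochains Γ A (n + 1)) 0 c⟩ :: l, ?_, ?_⟩
        · simpa using hl
        · simp [lettersProj]
      | zero => simp
      | add x y _ _ hx hy => rw [mul_add]; exact add_mem hx hy
      | smul a x _ hx => rw [mul_smul_comm]; exact Submodule.smul_mem _ _ hx

theorem barCocycles_eq_ker : barCocycles Γ A =
    LinearMap.ker (cocycleMap (lettersD Γ A) (lettersSign Γ A) (lettersProj Γ A) (lettersCup Γ A)) := by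
  ext x
  simp only [barCocycles, Submodule.mem_inf, mem_barDegree_zero, LinearMap.mem_ker, cocycleMap,
    LinearMap.prod_apply, barD, Function.prod, Prod.mk_eq_zero, LinearMap.sub_apply, LinearMap.id_apply,
    AlgHom.toLinearMap_apply, sub_eq_zero]
  tauto

section PID
variable [IsDomain A] [IsPrincipalIdealRing A]

instance flat_letters : Module.Flat A (Letters Γ A) := by
  infer_instance

instance flat_H0Bar : Module.Flat A (H0Bar Γ A) :=
  Module.Flat.of_linearEquiv (LinearEquiv.ofInjective (H0Bar.incl (Γ := Γ) (A := A)) H0Bar.incl_injective)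

theorem deconc_mem_H0Bar (x : H0Bar Γ A) : deconc A (Letters Γ A) x.incl ∈
    LinearMap.range (TensorProduct.map (H0Bar.incl (Γ := Γ) (A := A)) (H0Bar.incl (Γ := Γ) (A := A))) := by
  have hx : H0Bar.incl x ∈ barCocycles Γ A := x.2
  rw [barCocycles, Submodule.mem_inf, mem_barDegree_zero] at hx
  have h := deconc_cocycle _ _ _ _ lettersProj_D lettersProj_cup lettersProj_sign lettersProj_proj _ hx.2 hx.1
  refine mem_range_map_of_exact _ _ H0Bar.incl_injective ?_ _ h.1 h.2
  intro y
  rw [← LinearMap.mem_ker, ← barCocycles_eq_ker]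
  exact ⟨fun hy => ⟨⟨y, hy⟩, rfl⟩, fun ⟨z, hz⟩ => hz ▸ z.2⟩

/-- The coalgebra structure of `H⁰_Bar(Γ;A)`. Its coproduct is the deconcatenation of cocycles, seen in
`H⁰ ⊗ H⁰` through the injective map `H⁰ ⊗ H⁰ → Bar ⊗ Bar`; its counit is the projection to weight zero. -/
instance coalgebraH0Bar : Coalgebra A (H0Bar Γ A) :=
  subCoalgebra H0Bar.incl (deconc A (Letters Γ A)) H0Bar.incl_injective
    TensorAlgebra.algebraMapInv.toLinearMap
    deconc_mem_H0Bar deconc_counit_left deconc_counit_right deconc_coassoc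

end PID
end Cochains

section Pullback
universe u v
variable {Γ : Type u} [Group Γ] {A : Type v} [CommRing A] {Γ' : Type*} [Group Γ'] (h : Γ →* Γ')

theorem lettersMap_D (x : Letters Γ' A) :
    lettersD Γ A (lettersMap h x) = lettersMap h (lettersD Γ' A x) := by
  refine letters_hom_ext (f := lettersD Γ A ∘ₗ lettersMap h) (g := lettersMap h ∘ₗ lettersD Γ' A)
    (fun n c => ?_) x
  simp only [lettersD, lettersMap, LinearMap.comp_apply, DirectSum.toModule_lof]
  congr 1
  ext g
  have hc (j : Fin (n + 2)) : (fun i => h (Fin.contractNth j (· * ·) g i)) =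
      Fin.contractNth j (· * ·) (fun i => h (g i)) := by
    funext i
    simp only [Fin.contractNth]
    split_ifs <;> simp
  simp [coboundary, coboundaryFun, cochainsMap, hc]

theorem lettersMap_sign (x : Letters Γ' A) :
    lettersSign Γ A (lettersMap h x) = lettersMap h (lettersSign Γ' A x) := by
  refine letters_hom_ext (f := lettersSign Γ A ∘ₗ lettersMap h) (g := lettersMap h ∘ₗ lettersSign Γ' A)
    (fun n c => ?_) x
  simp [lettersSign, lettersMap]

theorem lettersMap_proj (x : Letters Γ' A) :
    lettersProj Γ A (lettersMap h x) = lettersMap h (lettersProj Γ' A x) := by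
  refine letters_hom_ext (f := lettersProj Γ A ∘ₗ lettersMap h) (g := lettersMap h ∘ₗ lettersProj Γ' A)
    (fun n c => ?_) x
  cases n with
  | zero => simp [lettersMap, lettersProj_lof_zero]
  | succ n => simp [lettersMap, lettersProj_lof_succ]

theorem lettersMap_cup (x y : Letters Γ' A) :
    lettersCup Γ A (lettersMap h x) (lettersMap h y) = lettersMap h (lettersCup Γ' A x y) := by
  refine letters_hom_ext (f := (lettersCup Γ A).flip (lettersMap h y) ∘ₗ lettersMap h)
    (g := lettersMap h ∘ₗ (lettersCup Γ' A).flip y) (fun n c => ?_) x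
  refine letters_hom_ext (f := (lettersCup Γ A) (lettersMap h
      (DirectSum.lof A ℕ (fun n => cochains Γ' A (n + 1)) n c)) ∘ₗ lettersMap h)
    (g := lettersMap h ∘ₗ lettersCup Γ' A
      (DirectSum.lof A ℕ (fun n => cochains Γ' A (n + 1)) n c)) (fun m c' => ?_) y
  simp only [lettersCup, lettersMap, LinearMap.comp_apply, DirectSum.toModule_lof,
    LinearMap.flip_apply, LinearMap.compr₂_apply]
  rfl

/-- The pullback `Bar(Γ';A) → Bar(Γ;A)`. -/
def barMap : Bar Γ' A →ₐ[A] Bar Γ A := tensorMap (lettersMap h)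

theorem barMap_mem (x : Bar Γ' A) (hx : x ∈ barCocycles Γ' A) : barMap h x ∈ barCocycles Γ A := by
  rw [barCocycles, Submodule.mem_inf, mem_barDegree_zero, LinearMap.mem_ker, barD] at hx ⊢
  have hp : tensorMap (lettersProj Γ A) (tensorMap (lettersMap h) x) =
      tensorMap (lettersMap h) (tensorMap (lettersProj Γ' A) x) := by
    have : (tensorMap (lettersProj Γ A)).comp (tensorMap (lettersMap (A := A) h)) =
        (tensorMap (lettersMap h)).comp (tensorMap (lettersProj Γ' A)) := by
      ext c
      simp [lettersMap_proj]
    exact DFunLike.congr_fun this x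
  refine ⟨?_, ?_⟩
  · rw [barMap, hp, hx.1]
  · rw [barMap, barDiff_map (lettersMap h) _ _ _ _ _ _ (lettersMap_D h) (lettersMap_sign h)
      (lettersMap_cup h), hx.2, map_zero]

/-- The linear map underlying the pullback on `H⁰_Bar`: the restriction of `Bar(Γ';A) → Bar(Γ;A)`. -/
def pullbackLinear : H0Bar Γ' A →ₗ[A] H0Bar Γ A :=
  LinearMap.codRestrict (barCocycles Γ A) ((barMap h).toLinearMap ∘ₗ H0Bar.incl)
    fun x => barMap_mem h x.incl x.2

theorem incl_pullbackLinear (x : H0Bar Γ' A) : (pullbackLinear h x).incl = barMap h x.incl :=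
  rfl

section PID
variable [IsDomain A] [IsPrincipalIdealRing A]

/-- The coproduct of `H⁰_Bar` is given by deconcatenation. -/
theorem map_incl_comul (x : H0Bar Γ A) : TensorProduct.map H0Bar.incl H0Bar.incl
    (Coalgebra.comul (R := A) x) = deconc A (Letters Γ A) x.incl :=
  map_subComul _ _ _ _ x

/-- The counit of `H⁰_Bar` is the projection to weight zero. -/
theorem counit_eq (x : H0Bar Γ A) :
    Coalgebra.counit (R := A) x = TensorAlgebra.algebraMapInv x.incl :=
  rfl

variable (A) in
/-- The pullback `h^* : H⁰_Bar(Γ';A) → H⁰_Bar(Γ;A)` of coalgebras along `h : Γ → Γ'`. -/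
def pullback : H0Bar Γ' A →ₗc[A] H0Bar Γ A where
  toLinearMap := pullbackLinear h
  counit_comp := by
    ext x
    simp only [LinearMap.comp_apply, counit_eq, incl_pullbackLinear]
    have : (TensorAlgebra.algebraMapInv).comp (barMap (A := A) h) = TensorAlgebra.algebraMapInv := by
      ext c
      simp [barMap, TensorAlgebra.algebraMapInv]
    exact DFunLike.congr_fun this x.incl
  map_comp_comul := by
    have hinj : Function.Injective (TensorProduct.map (H0Bar.incl (Γ := Γ) (A := A)) (H0Bar.incl (Γ := Γ) (A := A))) :=
      TensorProduct.map_injective_of_flat_flat _ _ H0Bar.incl_injective H0Bar.incl_injective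
    refine LinearMap.ext fun x => hinj ?_
    have hz (z : H0Bar Γ' A ⊗[A] H0Bar Γ' A) :
        TensorProduct.map (H0Bar.incl (Γ := Γ) (A := A)) (H0Bar.incl (Γ := Γ) (A := A))
          (TensorProduct.map (pullbackLinear h) (pullbackLinear h) z) =
        TensorProduct.map (barMap h).toLinearMap (barMap h).toLinearMap
          (TensorProduct.map (H0Bar.incl (Γ := Γ') (A := A)) (H0Bar.incl (Γ := Γ') (A := A)) z) := by
      induction z using TensorProduct.induction_on with
      | zero => simp
      | tmul a b => simp [incl_pullbackLinear]
      | add a b ha hb => simp only [map_add, ha, hb]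
    simp only [LinearMap.comp_apply]
    rw [hz, map_incl_comul, map_incl_comul, incl_pullbackLinear]
    exact (deconc_map (lettersMap h) x.incl).symm

end PID

end Pullback

section Pairing
universe u v
variable {Γ : Type u} [Group Γ] {A : Type v} [CommRing A]

/-- An element `w : Γ` is an edge of `BΓ`, thus a pointed simplicial map from the circle `S¹ = Δ[1]/∂Δ[1]` to `BΓ`
in the homotopy class `w`. The normalized cochains of `S¹` are `A ⊕ Aτ` with `τ` the dual of the edge, so
`s⁻¹C̄(S¹) = A t` in degree zero. This is the pullback `s⁻¹C̄(BΓ) → A t ≅ A`. -/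
def edgeEval (w : Γ) : Letters Γ A →ₗ[A] A :=
  LinearMap.proj (fun _ : Fin 1 => w) ∘ₗ (cochains Γ A 1).subtype ∘ₗ
    DirectSum.component A ℕ (fun n => cochains Γ A (n + 1)) 0

/-- The pullback `w^* : Bar(Γ;A) → Bar(S¹;A) = ⨁_p A t^{⊗p} = A[t]`, so that
`c₁|…|c_p ↦ c₁(w)⋯c_p(w) t^p` (the differential of `Bar(S¹;A)` is zero). -/
def edgePullback (w : Γ) : Bar Γ A →ₐ[A] Polynomial A :=
  TensorAlgebra.lift A ((LinearMap.toSpanSingleton A (Polynomial A) Polynomial.X) ∘ₗ edgeEval w)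

/-- The letter-braiding polynomial `L_T(w) = w^* T ∈ H⁰_Bar(S¹;A) = A[t]`. -/
def braidingPolynomial (w : Γ) : H0Bar Γ A →ₗ[A] Polynomial A :=
  (edgePullback w).toLinearMap ∘ₗ H0Bar.incl

/-- The letter-braiding number `ℓ_T(w)`: the linear coefficient of `L_T(w)`. -/
def braidingNumber (w : Γ) : H0Bar Γ A →ₗ[A] A :=
  Polynomial.lcoeff A 1 ∘ₗ braidingPolynomial w

variable [IsDomain A] [IsPrincipalIdealRing A]

/-- The functional `⟨T, •⟩ : A[Γ] → A`, the linear extension of `w ↦ ℓ_T(w) + η(T)`. -/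
def pairing (T : H0Bar Γ A) : MonoidAlgebra A Γ →ₗ[A] A :=
  Finsupp.lsum A (fun w : Γ => LinearMap.toSpanSingleton A A
      (braidingNumber w T + Coalgebra.counit (R := A) T)) ∘ₗ
    (MonoidAlgebra.coeffLinearEquiv A).toLinearMap

variable (Γ A) in
/-- The element `1` of `H⁰_Bar(Γ;A)` given by the coaugmentation. -/
def augOne : H0Bar Γ A := ⟨1, by
  refine ⟨Submodule.subset_span ⟨[], by simp, by simp⟩, ?_⟩
  simp [barD]⟩

variable (Γ A) in
/-- The projection `T ↦ T - η(T)·1` to the reduced coalgebra. -/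
def reduce : H0Bar Γ A →ₗ[A] H0Bar Γ A :=
  LinearMap.id - LinearMap.toSpanSingleton A (H0Bar Γ A) (augOne Γ A) ∘ₗ Coalgebra.counit (R := A)

variable (Γ A) in
/-- The reduced coproduct `Δ̄(T) = Δ(T) - 1 ⊗ T - T ⊗ 1` for `η(T) = 0`, extended to `H⁰_Bar` by `T ↦ T - η(T)·1`. -/
def redComul : H0Bar Γ A →ₗ[A] H0Bar Γ A ⊗[A] H0Bar Γ A :=
  (Coalgebra.comul (R := A) (A := H0Bar Γ A) - TensorProduct.mk A (H0Bar Γ A) (H0Bar Γ A) (augOne Γ A) -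
    (TensorProduct.mk A (H0Bar Γ A) (H0Bar Γ A)).flip (augOne Γ A)) ∘ₗ reduce Γ A

variable (Γ A) in
/-- The iterated reduced coproduct `Δ̄ⁿ : H⁰ → (H⁰)^{⊗(n+1)}`, with `Δ̄⁰ = id`. The step
`Δ̄ⁿ⁺¹ = (Δ̄ ⊗ id^{⊗n}) ∘ Δ̄ⁿ` is written in the equal form `Δ̄ⁿ⁺¹ = (Δ̄ⁿ ⊗ id) ∘ Δ̄`: both are the composite
`(Δ̄ ⊗ id^{⊗n}) ∘ … ∘ (Δ̄ ⊗ id) ∘ Δ̄`. -/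
def iterRedComul : (n : ℕ) → H0Bar Γ A →ₗ[A] ⨂[A]^(n + 1) (H0Bar Γ A)
  | 0 => (PiTensorProduct.subsingletonEquiv (R := A) (s := fun _ : Fin 1 => H0Bar Γ A) 0).symm.toLinearMap
  | n + 1 => (TensorPower.mulEquiv (R := A) (M := H0Bar Γ A) (n := n + 1) (m := 1)).toLinearMap ∘ₗ
      TensorProduct.map (iterRedComul n)
        (PiTensorProduct.subsingletonEquiv (R := A) (s := fun _ : Fin 1 => H0Bar Γ A) 0).symm.toLinearMap ∘ₗ
      redComul Γ A

/-- The multi-evaluation `ℓ_T(w₀|…|w_n) = (ℓ(w₀) ⊗ … ⊗ ℓ(w_n)) (Δ̄ⁿ T)`. -/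
def multiEval {n : ℕ} (w : Fin (n + 1) → Γ) : H0Bar Γ A →ₗ[A] A :=
  PiTensorProduct.lift ((MultilinearMap.mkPiAlgebra A (Fin (n + 1)) A).compLinearMap
    fun i => braidingNumber (w i)) ∘ₗ
    iterRedComul Γ A n

/-- A submodule `N` of a coalgebra with `Δ(N) ⊆ N ⊗ N`. -/
def IsSubcoalgebra {C : Type*} [AddCommGroup C] [Module A C] [Coalgebra A C] (N : Submodule A C) : Prop :=
  ∀ x ∈ N, Coalgebra.comul (R := A) x ∈ LinearMap.range (TensorProduct.mapIncl N N)

end Pairing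
end LetterBraiding
end

open LetterBraiding

/-! Everything rests on an action of Γ on `H0Bar Γ A`. Write e_w for the contraction of the first
letter of a class with its value at w (`edgeContract`). Evaluation on an edge has degree zero and
kills coboundaries and cup products, so e_w maps cocycles of degree zero to such cocycles.
Contracting dT = 0 with evaluation on the 2-simplex (a, b), whose faces are b, ab and a, gives
e_{ab} = e_a + e_b + e_b e_a. Hence τ_w = 1 + e_w satisfies τ_{ab} = τ_b τ_a (`translate_mul`), and
⟨T, w⟩ = η(τ_w T).

The multi-evaluation ℓ_T(w₀|…|w_n) is η(e_{w_n} ⋯ e_{w₀} T) (`multiEval_eq`), because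
deconcatenation is dual to concatenation of words. Over a principal ideal domain these evaluations,
the empty word included, separate classes (`eq_zero_of_forall_evalClass`). As e_w = τ_w - 1, the
function w ↦ ⟨T, w⟩ already determines T. So (3) says that τ_w T depends only on p(w).

(3) gives (1): choose a set-theoretic section s of p with s(1) = 1. The tensor s^*T need not be a
cocycle a priori, but p^*s^*T has on every word the value of T with each w replaced by s(p(w)),
which is the same by invariance. So p^*s^*T = T, and d(s^*T) = 0 because p^* is injective on the bar
construction (`mem_range_pullback`).

(1) gives (2) by naturality. (2) gives (3): ℓ_T(ab) = ℓ_T(a) + ℓ_T(b) + ∑ ℓ_{T₁}(a) ℓ_{T₂}(b), and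
the last sum vanishes as soon as a or b lies in ⟨R⟩; so ℓ_T vanishes on ⟨R⟩ and is constant on its
cosets. (3) and (4) are equivalent because both say that τ_k fixes all translates of T for k in ⟨R⟩.
-/

noncomputable section
namespace LetterBraiding

/-! ### Contraction of the first letter of a tensor -/

section Contraction
variable {A : Type*} [CommRing A] {W : Type*} [AddCommMonoid W] [Module A W]

/-- Contraction of the first letter with a functional: `1 ↦ 0` and `c|x ↦ φ(c) x`. -/
def contract (φ : W →ₗ[A] A) : TensorAlgebra A W →ₗ[A] TensorAlgebra A W :=
  (TensorProduct.lid A (TensorAlgebra A W)).toLinearMap ∘ₗ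
    LinearMap.rTensor (TensorAlgebra A W) φ ∘ₗ uncons A W

@[simp] theorem contract_one (φ : W →ₗ[A] A) : contract φ 1 = 0 := by simp [contract]

@[simp] theorem contract_cons (φ : W →ₗ[A] A) (c : W) (x : TensorAlgebra A W) :
    contract φ (TensorAlgebra.ι A c * x) = φ c • x := by
  simp [contract]

/-- Evaluation of tensors on a word of functionals: `c₁|…|c_p ↦ φ₁(c₁)⋯φ_p(c_p)` on tensors of weight
`p`, the length of the word, and zero on the other weights. -/
def evalWord : List (W →ₗ[A] A) → TensorAlgebra A W →ₗ[A] A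
  | [] => TensorAlgebra.algebraMapInv.toLinearMap
  | φ :: l => evalWord l ∘ₗ contract φ

theorem evalWord_one_of_ne_nil {l : List (W →ₗ[A] A)} (hl : l ≠ []) :
    evalWord l (1 : TensorAlgebra A W) = 0 := by
  cases l with
  | nil => exact absurd rfl hl
  | cons φ l => simp [evalWord]

theorem algebraMapInv_cons (c : W) (x : TensorAlgebra A W) :
    TensorAlgebra.algebraMapInv (TensorAlgebra.ι A c * x) = 0 := by
  simp [TensorAlgebra.algebraMapInv]

/-- In Δ(c|x) the left factor of each term is either 1, which contraction kills, or begins with c.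
So contraction is a map of comodules for deconcatenation on the right. -/
theorem rTensor_contract_deconc (φ : W →ₗ[A] A) (x : TensorAlgebra A W) :
    LinearMap.rTensor _ (contract φ) (deconc A W x) = deconc A W (contract φ x) := by
  have h (c : W) (y : TensorAlgebra A W ⊗[A] TensorAlgebra A W) :
      LinearMap.rTensor _ (contract φ) ((TensorAlgebra.ι A c ⊗ₜ[A] 1) * y) = φ c • y := by
    induction y using TensorProduct.induction_on with
    | zero => simp
    | tmul a b => simp [TensorProduct.smul_tmul']
    | add a b ha hb => simp only [mul_add, map_add, ha, hb, smul_add]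
  induction x using tensor_induction with
  | one => simp
  | add x y hx hy => simp only [map_add, hx, hy]
  | smul a x hx => simp only [map_smul, hx]
  | cons c x hx => simp [h]

theorem contract_tensorMap {W' : Type*} [AddCommMonoid W'] [Module A W'] (f : W →ₗ[A] W')
    (φ : W' →ₗ[A] A) (x : TensorAlgebra A W) :
    contract φ (tensorMap f x) = tensorMap f (contract (φ ∘ₗ f) x) := by
  induction x using tensor_induction with
  | one => simp
  | add x y hx hy => simp only [map_add, hx, hy]
  | smul a x hx => simp only [map_smul, hx]
  | cons c x hx => simp

theorem algebraMapInv_tensorMap {W' : Type*} [AddCommMonoid W'] [Module A W'] (f : W →ₗ[A] W')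
    (x : TensorAlgebra A W) :
    TensorAlgebra.algebraMapInv (tensorMap f x) = TensorAlgebra.algebraMapInv x := by
  induction x using tensor_induction with
  | one => simp
  | add x y hx hy => simp only [map_add, hx, hy]
  | smul a x hx => simp only [map_smul, hx]
  | cons c x hx => simp [algebraMapInv_cons]

theorem evalWord_tensorMap {W' : Type*} [AddCommMonoid W'] [Module A W'] (f : W →ₗ[A] W')
    (l : List (W' →ₗ[A] A)) (x : TensorAlgebra A W) :
    evalWord l (tensorMap f x) = evalWord (l.map (· ∘ₗ f)) x := by
  induction l generalizing x with
  | nil => exact algebraMapInv_tensorMap f x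
  | cons φ l ih => simp [evalWord, contract_tensorMap, ih]

theorem tensorMap_comp {W' W'' : Type*} [AddCommMonoid W'] [Module A W'] [AddCommMonoid W'']
    [Module A W''] (f : W →ₗ[A] W') (g : W' →ₗ[A] W'') (h : W →ₗ[A] W'') (hf : ∀ c, g (f c) = h c)
    (x : TensorAlgebra A W) : tensorMap g (tensorMap f x) = tensorMap h x := by
  have : (tensorMap g).comp (tensorMap f) = tensorMap (A := A) h := by
    ext c
    simp [hf]
  exact DFunLike.congr_fun this x

theorem tensorMap_id (f : W →ₗ[A] W) (hf : ∀ c, f c = c) (x : TensorAlgebra A W) :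
    tensorMap f x = x := by
  have : tensorMap f = AlgHom.id A (TensorAlgebra A W) := by
    ext c
    simp [hf]
  exact DFunLike.congr_fun this x

/-- Contraction with a functional of degree zero commutes with the bar differential. -/
theorem contract_barDiff (δ σ : W →ₗ[A] W) (μ : W →ₗ[A] W →ₗ[A] W) (φ : W →ₗ[A] A)
    (hδ : ∀ c, φ (δ c) = 0) (hσ : ∀ c, φ (σ c) = φ c) (hμ : ∀ c c', φ (μ c c') = 0)
    (x : TensorAlgebra A W) :
    contract φ (barDiff δ σ μ x) = barDiff δ σ μ (contract φ x) := by
  -- The first letter of an absorbed tensor is a product, which φ kills. Of d(c|x) only σ(c)|dx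
  -- survives, and φ(σ c) = φ(c).
  have h (c : W) (x : TensorAlgebra A W) : contract φ (absorb μ c x) = 0 := by
    induction x using tensor_induction with
    | one => simp
    | add x y hx hy => simp only [map_add, hx, hy, add_zero]
    | smul a x hx => simp only [map_smul, hx, smul_zero]
    | cons c x hx => simp [hμ]
  induction x using tensor_induction with
  | one => simp
  | add x y hx hy => simp only [map_add, hx, hy]
  | smul a x hx => simp only [map_smul, hx]
  | cons c x hx => simp [hδ, hσ, h]

/-- Contraction of the bar differential with a functional of degree one whose values on coboundaries and
products are given by functionals of degree zero. -/
theorem contract_barDiff_of_degree_one (δ σ : W →ₗ[A] W) (μ : W →ₗ[A] W →ₗ[A] W)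
    (ψ φ α β : W →ₗ[A] A) (hδ : ∀ c, ψ (δ c) = φ c) (hσ : ∀ c, ψ (σ c) = -ψ c)
    (hα : ∀ c, α (σ c) = α c) (hμ : ∀ c c', ψ (μ c c') = α c * β c') (x : TensorAlgebra A W) :
    contract ψ (barDiff δ σ μ x) =
      -contract φ x - contract β (contract α x) - barDiff δ σ μ (contract ψ x) := by
  -- Evaluating the product of the first two letters splits into two successive contractions, α on
  -- the first letter and β on the second.
  have h (c : W) (x : TensorAlgebra A W) : contract ψ (absorb μ c x) = α c • contract β x := by
    induction x using tensor_induction with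
    | one => simp
    | add x y hx hy => simp only [map_add, hx, hy, smul_add]
    | smul a x hx => simp only [map_smul, hx, smul_comm a]
    | cons c x hx => simp [hμ, mul_smul]
  induction x using tensor_induction with
  | one => simp
  | add x y hx hy => simp only [map_add, hx, hy]; abel
  | smul a x hx => simp only [map_smul, hx, smul_sub, smul_neg]
  | cons c x hx => simp [hδ, hσ, hα, h]; abel

theorem contract_zero : contract (0 : W →ₗ[A] A) = 0 := by
  simp [contract]

end Contraction

/-! ### Separation of tensors by words of functionals -/

section Separation
variable {A : Type*} [CommRing A] {W : Type*} [AddCommGroup W] [Module A W]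

/-- Over a principal ideal domain, functionals that separate the points of `W` also separate the points of
`W ⊗ M` when `M` is torsion free. -/
theorem tensor_eq_zero_of_forall_rTensor [IsDomain A] [IsPrincipalIdealRing A] {M : Type*}
    [AddCommGroup M] [Module A M] [Module.IsTorsionFree A M] {Ω : Type*} (φ : Ω → W →ₗ[A] A)
    (hφ : ∀ c, (∀ w, φ w c = 0) → c = 0) (z : W ⊗[A] M)
    (hz : ∀ w, LinearMap.rTensor M (φ w) z = 0) : z = 0 := by
  -- The right factors of z span a finitely generated torsion-free module N, which is free over a
  -- principal ideal domain. In a basis of N the coefficients of z lie in W, and every functional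
  -- kills each of them.
  obtain ⟨N, hN, hzN⟩ := TensorProduct.exists_finite_submodule_right_of_setFinite {z}
    (Set.finite_singleton z)
  obtain ⟨y, rfl⟩ := hzN (Set.mem_singleton z)
  let b := Module.Free.chooseBasis A N
  have hinj : Function.Injective (LinearMap.lTensor A N.subtype) :=
    Module.Flat.lTensor_preserves_injective_linearMap _ N.subtype_injective
  have hy (w : Ω) : LinearMap.rTensor N (φ w) y = 0 := by
    refine hinj ?_
    rw [map_zero, ← hz w, ← LinearMap.comp_apply, ← LinearMap.comp_apply,
      LinearMap.lTensor_comp_rTensor, LinearMap.rTensor_comp_lTensor]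
  obtain ⟨c, rfl⟩ := TensorProduct.eq_repr_basis_right b y
  have hc : c = 0 := by
    refine Finsupp.ext fun j => hφ _ fun w => ?_
    have h1 := congrArg (fun t => b.repr (TensorProduct.lid A N t) j) (hy w)
    by_contra hne
    refine hne ?_
    have h2 : c j ≠ 0 := fun h => hne (by simp [h])
    simpa [Finsupp.sum, Finsupp.single_apply, Finsupp.finsetSum_apply, h2] using h1
  simp [hc]

/-- The tensors that every `n`-fold contraction kills. -/
def contractFiltration {Ω : Type*} (φ : Ω → W →ₗ[A] A) : ℕ → Submodule A (TensorAlgebra A W)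
  | 0 => ⊥
  | n + 1 => ⨅ w, (contractFiltration φ n).comap (contract (φ w))

theorem contractFiltration_le_succ {Ω : Type*} (φ : Ω → W →ₗ[A] A) (n : ℕ) :
    contractFiltration φ n ≤ contractFiltration φ (n + 1) := by
  induction n with
  | zero => exact bot_le
  | succ n ih => exact iInf_mono fun w => Submodule.comap_mono ih

/-- Each contraction removes a letter, and the weights in a tensor are bounded. The bound n makes
induction on the number of contractions possible in `eq_zero_of_forall_evalWord`. -/
theorem exists_mem_contractFiltration {Ω : Type*} (φ : Ω → W →ₗ[A] A) (x : TensorAlgebra A W) :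
    ∃ n, x ∈ contractFiltration φ n := by
  have hmono : Monotone (contractFiltration φ) := monotone_nat_of_le_succ (contractFiltration_le_succ φ)
  induction x using tensor_induction with
  | one => exact ⟨1, by simp [contractFiltration]⟩
  | add x y hx hy =>
    obtain ⟨n, hn⟩ := hx
    obtain ⟨m, hm⟩ := hy
    exact ⟨max n m, add_mem (hmono (le_max_left n m) hn) (hmono (le_max_right n m) hm)⟩
  | smul a x hx =>
    obtain ⟨n, hn⟩ := hx
    exact ⟨n, Submodule.smul_mem _ a hn⟩
  | cons c x hx =>
    obtain ⟨n, hn⟩ := hx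
    refine ⟨n + 1, ?_⟩
    simp only [contractFiltration, Submodule.mem_iInf, Submodule.mem_comap, contract_cons]
    exact fun w => Submodule.smul_mem _ _ hn

/-- A tensor is its part of weight zero plus what is recovered from `uncons` by multiplying the
first letter back. -/
theorem eq_zero_of_uncons_eq_zero (x : TensorAlgebra A W)
    (h0 : TensorAlgebra.algebraMapInv x = 0) (h1 : uncons A W x = 0) : x = 0 := by
  have key : x = algebraMap A _ (TensorAlgebra.algebraMapInv x) +
      TensorProduct.lift (LinearMap.mul A (TensorAlgebra A W) ∘ₗ TensorAlgebra.ι A) (uncons A W x) := by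
    clear h0 h1
    induction x using tensor_induction with
    | one => simp
    | add x y hx hy =>
      conv_lhs => rw [hx, hy]
      simp only [map_add]
      abel
    | smul a x hx =>
      rw [map_smul, smul_eq_mul, map_mul, ← Algebra.smul_def, LinearMap.map_smul,
        LinearMap.map_smul, ← smul_add, ← hx]
    | cons c x hx => simp [algebraMapInv_cons]
  rw [key, h0, h1, map_zero, map_zero, add_zero]

/-- Over a principal ideal domain, words in functionals that separate the points of `W` separate the
points of the tensor algebra of `W`. -/
theorem eq_zero_of_forall_evalWord [IsDomain A] [IsPrincipalIdealRing A] [Module.Flat A W]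
    {Ω : Type*} (φ : Ω → W →ₗ[A] A) (hφ : ∀ c, (∀ w, φ w c = 0) → c = 0) (x : TensorAlgebra A W)
    (hx : ∀ l : List Ω, evalWord (l.map φ) x = 0) : x = 0 := by
  obtain ⟨n, hn⟩ := exists_mem_contractFiltration φ x
  induction n generalizing x with
  | zero => exact hn
  | succ n ih =>
    simp only [contractFiltration, Submodule.mem_iInf, Submodule.mem_comap] at hn
    -- The empty word sees the weight-zero part. The rest lies in W ⊗ T(W), where T(W) is flat,
    -- hence torsion free; the words beginning with w are the words evaluated on the contraction by
    -- w.
    refine eq_zero_of_uncons_eq_zero x (hx []) ?_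
    refine tensor_eq_zero_of_forall_rTensor φ hφ _ fun w => ?_
    refine (TensorProduct.lid A (TensorAlgebra A W)).injective ?_
    rw [map_zero]
    exact ih (contract (φ w) x) (fun l => hx (w :: l)) (hn w)

end Separation
-- Pullback of cochains along set-theoretic sections
section Pull
variable {Γ : Type*} [Group Γ] {A : Type*} [CommRing A] {Γ' : Type*} [Group Γ']

/-- Pullback of cochains along a map `s` with `s 1 = 1`, which need not be a homomorphism. -/
def cochainsPull (s : Γ → Γ') (hs : s 1 = 1) (n : ℕ) : cochains Γ' A n →ₗ[A] cochains Γ A n where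
  toFun f := ⟨fun g => f.1 (fun i => s (g i)), fun g ⟨i, hi⟩ => f.2 _ ⟨i, by simp [hi, hs]⟩⟩
  map_add' f f' := by ext g; simp
  map_smul' a f := by ext g; simp

/-- Pullback along a map `s` with `s 1 = 1` on `s⁻¹C̄`. -/
def lettersPull (s : Γ → Γ') (hs : s 1 = 1) : Letters Γ' A →ₗ[A] Letters Γ A :=
  DirectSum.toModule A ℕ _ fun n =>
    DirectSum.lof A ℕ (fun n => cochains Γ A (n + 1)) n ∘ₗ cochainsPull s hs (n + 1)

theorem lettersMap_eq_lettersPull (h : Γ →* Γ') :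
    lettersMap (A := A) h = lettersPull h (map_one h) := rfl

theorem lettersPull_proj (s : Γ → Γ') (hs : s 1 = 1) (x : Letters Γ' A) :
    lettersProj Γ A (lettersPull s hs x) = lettersPull s hs (lettersProj Γ' A x) := by
  refine letters_hom_ext (f := lettersProj Γ A ∘ₗ lettersPull s hs)
    (g := lettersPull s hs ∘ₗ lettersProj Γ' A) (fun n c => ?_) x
  cases n with
  | zero => simp [lettersPull, lettersProj_lof_zero]
  | succ n => simp [lettersPull, lettersProj_lof_succ]

theorem lettersPull_lettersMap (h : Γ →* Γ') (s : Γ' → Γ) (hs : s 1 = 1) (hsec : ∀ g, h (s g) = g)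
    (x : Letters Γ' A) : lettersPull s hs (lettersMap h x) = x := by
  refine letters_hom_ext (f := lettersPull s hs ∘ₗ lettersMap h) (g := LinearMap.id)
    (fun n c => ?_) x
  simp only [lettersPull, lettersMap, LinearMap.comp_apply, DirectSum.toModule_lof, LinearMap.id_apply]
  congr 1
  ext g
  simp [cochainsPull, cochainsMap, hsec]

theorem edgeEval_lettersPull (s : Γ → Γ') (hs : s 1 = 1) (w : Γ) :
    edgeEval w ∘ₗ lettersPull (A := A) s hs = edgeEval (s w) := by
  refine LinearMap.ext fun x => letters_hom_ext (fun n c => ?_) x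
  cases n with
  | zero => simp [edgeEval, lettersPull, DirectSum.component.lof_self]; rfl
  | succ n => simp [edgeEval, lettersPull, DirectSum.component.of]

/-- A section of h that preserves 1 pulls normalized cochains back to normalized cochains, and this
gives a left inverse. The section need not be a homomorphism, so the left inverse need not commute
with the differential. -/
theorem barMap_injective (h : Γ →* Γ') (hh : Function.Surjective h) :
    Function.Injective (barMap (A := A) h) := by
  classical
  let s : Γ' → Γ := fun g => if g = 1 then 1 else Function.surjInv hh g
  have hs : s 1 = 1 := by simp [s]
  have hsec (g : Γ') : h (s g) = g := by
    by_cases hg : g = 1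
    · simp [s, hg]
    · simp [s, hg, Function.surjInv_eq hh]
  refine Function.LeftInverse.injective (g := tensorMap (lettersPull s hs)) fun x => ?_
  rw [barMap, tensorMap_comp _ _ LinearMap.id (lettersPull_lettersMap h s hs hsec)]
  exact tensorMap_id _ (fun _ => rfl) x

theorem barD_barMap (h : Γ →* Γ') (x : Bar Γ' A) : barD Γ A (barMap h x) = barMap h (barD Γ' A x) :=
  barDiff_map (lettersMap h) _ _ _ _ _ _ (lettersMap_D h) (lettersMap_sign h) (lettersMap_cup h) x

end Pull

/-! ### The action of the group on classes of degree zero -/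

section Translation
variable {Γ : Type*} [Group Γ] {A : Type*} [CommRing A]

theorem edgeEval_lof_zero (w : Γ) (c : cochains Γ A (0 + 1)) :
    edgeEval w (DirectSum.lof A ℕ (fun n => cochains Γ A (n + 1)) 0 c) = c.1 fun _ => w := by
  simp [edgeEval, DirectSum.component.lof_self]

theorem edgeEval_lof_succ (w : Γ) (n : ℕ) (c : cochains Γ A (n + 1 + 1)) :
    edgeEval w (DirectSum.lof A ℕ (fun n => cochains Γ A (n + 1)) (n + 1) c) = 0 := by
  simp [edgeEval, DirectSum.component.of]

/-- An edge sees only the letters of degree zero. The behaviour of `edgeEval` on coboundaries, signs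
and cup products then follows for degree reasons. -/
theorem edgeEval_proj (w : Γ) (x : Letters Γ A) : edgeEval w (lettersProj Γ A x) = edgeEval w x := by
  refine letters_hom_ext (f := edgeEval w ∘ₗ lettersProj Γ A) (g := edgeEval w) (fun n c => ?_) x
  cases n with
  | zero => simp [lettersProj_lof_zero]
  | succ n => simp [lettersProj_lof_succ, edgeEval_lof_succ]

theorem edgeEval_D (w : Γ) (x : Letters Γ A) : edgeEval w (lettersD Γ A x) = 0 := by
  rw [← edgeEval_proj, lettersProj_D, map_zero]

theorem edgeEval_sign (w : Γ) (x : Letters Γ A) : edgeEval w (lettersSign Γ A x) = edgeEval w x := by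
  rw [← edgeEval_proj, lettersProj_sign, edgeEval_proj]

theorem edgeEval_cup (w : Γ) (x y : Letters Γ A) : edgeEval w (lettersCup Γ A x y) = 0 := by
  rw [← edgeEval_proj, lettersProj_cup, map_zero]

theorem edgeEval_one : edgeEval (A := A) (1 : Γ) = 0 := by
  refine LinearMap.ext fun x => letters_hom_ext (fun n c => ?_) x
  cases n with
  | zero => rw [edgeEval_lof_zero]; exact c.2 _ ⟨0, rfl⟩
  | succ n => rw [edgeEval_lof_succ]; rfl

/-- Evaluation of the letters of degree one on the 2-simplex `(a, b)`. -/
def triangleEval (a b : Γ) : Letters Γ A →ₗ[A] A :=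
  LinearMap.proj (![a, b] : Fin 2 → Γ) ∘ₗ (cochains Γ A 2).subtype ∘ₗ
    DirectSum.component A ℕ (fun n => cochains Γ A (n + 1)) 1

theorem triangleEval_lof_one (a b : Γ) (c : cochains Γ A (1 + 1)) :
    triangleEval a b (DirectSum.lof A ℕ (fun n => cochains Γ A (n + 1)) 1 c) = c.1 ![a, b] := by
  simp [triangleEval, DirectSum.component.lof_self]

theorem triangleEval_lof_ne_one (a b : Γ) {n : ℕ} (hn : n ≠ 1) (c : cochains Γ A (n + 1)) :
    triangleEval a b (DirectSum.lof A ℕ (fun n => cochains Γ A (n + 1)) n c) = 0 := by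
  simp [triangleEval, DirectSum.component.of, hn]

/-- The faces of the 2-simplex (a, b) are b, ab and a. This is how the multiplication of Γ enters
the contraction formula. -/
theorem triangleEval_D (a b : Γ) (x : Letters Γ A) :
    triangleEval a b (lettersD Γ A x) = edgeEval a x + edgeEval b x - edgeEval (a * b) x := by
  refine letters_hom_ext (f := triangleEval a b ∘ₗ lettersD Γ A)
    (g := edgeEval a + edgeEval b - edgeEval (a * b)) (fun n c => ?_) x
  simp only [lettersD, LinearMap.comp_apply, DirectSum.toModule_lof, LinearMap.add_apply,
    LinearMap.sub_apply]
  cases n with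
  | zero =>
    rw [triangleEval_lof_one]
    simp only [edgeEval_lof_zero, coboundary, LinearMap.coe_mk, AddHom.coe_mk, coboundaryFun]
    have h0 : (fun i : Fin 1 => (![a, b] : Fin 2 → Γ) i.succ) = fun _ => b := by
      funext i; fin_cases i; rfl
    have h1 : Fin.contractNth (0 : Fin 2) (· * ·) (![a, b] : Fin 2 → Γ) = fun _ => a * b := by
      funext i; fin_cases i; rfl
    have h2 : Fin.contractNth (1 : Fin 2) (· * ·) (![a, b] : Fin 2 → Γ) = fun _ => a := by
      funext i; fin_cases i; rfl
    erw [h0, Fin.sum_univ_two, h1, h2]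
    simp
    ring
  | succ n => rw [triangleEval_lof_ne_one _ _ (by omega)]; simp [edgeEval_lof_succ]

theorem triangleEval_sign (a b : Γ) (x : Letters Γ A) :
    triangleEval a b (lettersSign Γ A x) = -triangleEval a b x := by
  refine letters_hom_ext (f := triangleEval a b ∘ₗ lettersSign Γ A) (g := -triangleEval a b)
    (fun n c => ?_) x
  by_cases hn : n = 1
  · subst hn; simp [lettersSign]
  · simp [lettersSign, triangleEval_lof_ne_one a b hn]

theorem triangleEval_cup (a b : Γ) (x y : Letters Γ A) :
    triangleEval a b (lettersCup Γ A x y) = edgeEval a x * edgeEval b y := by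
  refine letters_hom_ext (f := triangleEval a b ∘ₗ (lettersCup Γ A).flip y)
    (g := (edgeEval b y) • edgeEval a) (fun n c => ?_) x |>.trans (mul_comm _ _)
  refine letters_hom_ext (f := triangleEval a b ∘ₗ lettersCup Γ A
      (DirectSum.lof A ℕ (fun n => cochains Γ A (n + 1)) n c))
    (g := (edgeEval a (DirectSum.lof A ℕ (fun n => cochains Γ A (n + 1)) n c)) • edgeEval b)
    (fun m c' => ?_) y |>.trans (mul_comm _ _)
  simp only [lettersCup, LinearMap.comp_apply, DirectSum.toModule_lof,
    LinearMap.flip_apply, LinearMap.compr₂_apply, LinearMap.smul_apply, smul_eq_mul]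
  cases n with
  | succ n => rw [triangleEval_lof_ne_one _ _ (by omega), edgeEval_lof_succ, zero_mul]
  | zero =>
    cases m with
    | succ m => rw [triangleEval_lof_ne_one _ _ (by omega), edgeEval_lof_succ, mul_zero]
    | zero =>
      rw [edgeEval_lof_zero, edgeEval_lof_zero]
      refine (triangleEval_lof_one a b _).trans ?_
      simp only [cup, LinearMap.mk₂_apply]
      exact congrArg₂ (· * ·) (congrArg c.1 (funext fun i => by fin_cases i; rfl))
        (congrArg c'.1 (funext fun i => by fin_cases i; rfl))

theorem triangleEval_proj (a b : Γ) : triangleEval a b ∘ₗ lettersProj Γ A = 0 := by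
  refine LinearMap.ext fun x => letters_hom_ext (fun n c => ?_) x
  cases n with
  | zero => simp [lettersProj_lof_zero, triangleEval_lof_ne_one]
  | succ n => simp [lettersProj_lof_succ]

theorem tensorMap_proj_incl (T : H0Bar Γ A) : tensorMap (lettersProj Γ A) T.incl = T.incl :=
  (mem_barDegree_zero _).1 T.2.1

theorem barD_incl (T : H0Bar Γ A) : barD Γ A T.incl = 0 := T.2.2

theorem contract_edgeEval_mem (w : Γ) (T : H0Bar Γ A) :
    contract (edgeEval w) T.incl ∈ barCocycles Γ A := by
  refine ⟨(mem_barDegree_zero _).2 ?_, ?_⟩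
  · have : edgeEval w ∘ₗ lettersProj Γ A = edgeEval w := LinearMap.ext (edgeEval_proj w)
    conv_rhs => rw [← tensorMap_proj_incl, contract_tensorMap, this]
  · have := contract_barDiff _ _ _ _ (edgeEval_D (A := A) w) (edgeEval_sign w) (edgeEval_cup w) T.incl
    refine LinearMap.mem_ker.2 ?_
    rw [barD, ← this]
    exact (congrArg _ (barD_incl T)).trans (map_zero _)

/-- The contraction of the first letter of a class with `w : Γ`. -/
def edgeContract (w : Γ) : H0Bar Γ A →ₗ[A] H0Bar Γ A :=
  LinearMap.codRestrict (barCocycles Γ A) (contract (edgeEval w) ∘ₗ H0Bar.incl)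
    (contract_edgeEval_mem w)

theorem incl_edgeContract (w : Γ) (T : H0Bar Γ A) :
    (edgeContract w T).incl = contract (edgeEval w) T.incl := rfl

@[simp] theorem edgeContract_one : edgeContract (A := A) (1 : Γ) = 0 := by
  refine LinearMap.ext fun T => H0Bar.incl_injective ?_
  rw [incl_edgeContract, edgeEval_one, contract_zero]
  simp

/-- Contract dT = 0 with evaluation on the 2-simplex (a, b): the coboundary terms give the three
single contractions, and the cup product gives the double one. -/
theorem edgeContract_mul (a b : Γ) (T : H0Bar Γ A) : edgeContract (a * b) T =
    edgeContract a T + edgeContract b T + edgeContract b (edgeContract a T) := by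
  refine H0Bar.incl_injective ?_
  simp only [map_add, incl_edgeContract]
  have h := contract_barDiff_of_degree_one (lettersD Γ A) (lettersSign Γ A) (lettersCup Γ A)
    (triangleEval a b) (edgeEval a + edgeEval b - edgeEval (a * b)) (edgeEval a) (edgeEval b)
    (triangleEval_D a b) (triangleEval_sign a b) (edgeEval_sign a) (triangleEval_cup a b) T.incl
  -- T has degree zero, so no letter of degree one occurs in it.
  have h0 : contract (triangleEval a b) T.incl = 0 := by
    rw [← tensorMap_proj_incl, contract_tensorMap, triangleEval_proj, contract_zero]
    simp
  have h1 : barDiff (lettersD Γ A) (lettersSign Γ A) (lettersCup Γ A) T.incl = 0 := barD_incl T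
  have h2 : contract (edgeEval a + edgeEval b - edgeEval (a * b)) T.incl =
      contract (edgeEval a) T.incl + contract (edgeEval b) T.incl -
        contract (edgeEval (a * b)) T.incl := by
    simp [contract, LinearMap.rTensor_add, LinearMap.rTensor_sub]
  rw [h0, h1, h2, map_zero, map_zero] at h
  rw [← sub_eq_zero]
  refine Eq.trans ?_ h.symm
  abel

/-- The right translation by `w : Γ` on `H⁰_Bar`. -/
def translate (w : Γ) : H0Bar Γ A →ₗ[A] H0Bar Γ A := LinearMap.id + edgeContract w

theorem translate_apply (w : Γ) (T : H0Bar Γ A) : translate w T = T + edgeContract w T := rfl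

@[simp] theorem translate_one (T : H0Bar Γ A) : translate (1 : Γ) T = T := by
  simp [translate_apply]

/-- The formula for e_{ab} reads 1 + e_{ab} = (1 + e_b)(1 + e_a). The left factor of a product acts
first. -/
theorem translate_mul (a b : Γ) (T : H0Bar Γ A) :
    translate (a * b) T = translate b (translate a T) := by
  simp only [translate_apply, edgeContract_mul, map_add]
  abel

/-- Both coefficients are treated together, since the linear coefficient for c|x involves the
constant coefficient for x. -/
theorem algebraMapInv_contract_eq (w : Γ) (x : Bar Γ A) :
    (edgePullback w x).coeff 0 = TensorAlgebra.algebraMapInv x ∧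
    (edgePullback w x).coeff 1 = TensorAlgebra.algebraMapInv (contract (edgeEval w) x) := by
  induction x using tensor_induction with
  | one => simp [Polynomial.coeff_one]
  | add x y hx hy => simp only [map_add, Polynomial.coeff_add, hx, hy, true_and]
  | smul a x hx => simp only [map_smul, Polynomial.coeff_smul, hx, true_and]
  | cons c x hx =>
    have h (P : Polynomial A) : edgePullback w (TensorAlgebra.ι A c) * P =
        (edgeEval w c) • (Polynomial.X * P) := by
      simp [edgePullback]
    rw [map_mul, h, contract_cons, algebraMapInv_cons]
    simp [hx.1]

theorem braidingNumber_eq (w : Γ) (T : H0Bar Γ A) :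
    braidingNumber w T = TensorAlgebra.algebraMapInv (edgeContract w T).incl :=
  (algebraMapInv_contract_eq w T.incl).2

end Translation
-- Evaluation on words, and its compatibility with the coproduct
section Evaluation
variable {Γ : Type*} [Group Γ] {A : Type*} [CommRing A]

/-- Evaluation of a class on a word in the group. -/
def evalClass (l : List Γ) : H0Bar Γ A →ₗ[A] A :=
  evalWord (l.map edgeEval) ∘ₗ H0Bar.incl

theorem evalClass_cons (w : Γ) (l : List Γ) (T : H0Bar Γ A) :
    evalClass (w :: l) T = evalClass l (edgeContract w T) := rfl

theorem braidingNumber_eq_evalClass (w : Γ) : braidingNumber (A := A) w = evalClass [w] :=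
  LinearMap.ext fun T => braidingNumber_eq w T

theorem braidingNumber_one (T : H0Bar Γ A) : braidingNumber (1 : Γ) T = 0 := by
  rw [braidingNumber_eq_evalClass, evalClass_cons, edgeContract_one, LinearMap.zero_apply, map_zero]

/-- The failure of ℓ_T to be additive is an evaluation on a word of length two, which the reduced
coproduct computes. -/
theorem braidingNumber_mul (a b : Γ) (T : H0Bar Γ A) : braidingNumber (a * b) T =
    braidingNumber a T + braidingNumber b T + evalClass [a, b] T := by
  simp only [braidingNumber_eq_evalClass, evalClass_cons, edgeContract_mul, map_add]

theorem incl_augOne : (augOne Γ A).incl = 1 := rfl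

theorem evalClass_augOne {l : List Γ} (hl : l ≠ []) : evalClass l (augOne Γ A) = 0 :=
  evalWord_one_of_ne_nil (by simpa using hl)

theorem edgeContract_eq_sub (w : Γ) (T : H0Bar Γ A) : edgeContract w T = translate w T - T := by
  rw [translate_apply, add_sub_cancel_left]

theorem lift_mkPiAlgebra_mulEquiv {M : Type*} [AddCommGroup M] [Module A M] {n m : ℕ}
    (f : Fin (n + m) → M →ₗ[A] A) (x : ⨂[A]^n M) (y : ⨂[A]^m M) :
    PiTensorProduct.lift ((MultilinearMap.mkPiAlgebra A (Fin (n + m)) A).compLinearMap f)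
      (TensorPower.mulEquiv (x ⊗ₜ y)) =
    PiTensorProduct.lift ((MultilinearMap.mkPiAlgebra A (Fin n) A).compLinearMap
      fun i => f (Fin.castAdd m i)) x *
    PiTensorProduct.lift ((MultilinearMap.mkPiAlgebra A (Fin m) A).compLinearMap
      fun i => f (Fin.natAdd n i)) y := by
  induction x using PiTensorProduct.induction_on with
  | add x x' hx hx' => simp only [TensorProduct.add_tmul, map_add, hx, hx', add_mul]
  | smul_tprod r a =>
    induction y using PiTensorProduct.induction_on with
    | add y y' hy hy' => simp only [TensorProduct.tmul_add, map_add, hy, hy', mul_add]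
    | smul_tprod r' b =>
      have h := TensorPower.tprod_mul_tprod A a b
      rw [TensorPower.gMul_def] at h
      simp only [← TensorProduct.smul_tmul', TensorProduct.tmul_smul, map_smul, h,
        PiTensorProduct.lift.tprod, MultilinearMap.compLinearMap_apply,
        MultilinearMap.mkPiAlgebra_apply, Fin.prod_univ_add, Fin.append_left, Fin.append_right,
        smul_eq_mul]
      ring

theorem lift_mkPiAlgebra_subsingletonEquiv {M : Type*} [AddCommGroup M] [Module A M]
    (f : Fin 1 → M →ₗ[A] A) (x : M) :
    PiTensorProduct.lift ((MultilinearMap.mkPiAlgebra A (Fin 1) A).compLinearMap f)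
      ((PiTensorProduct.subsingletonEquiv (R := A) (s := fun _ : Fin 1 => M) 0).symm x) = f 0 x := by
  simp [PiTensorProduct.subsingletonEquiv]

variable [IsDomain A] [IsPrincipalIdealRing A]

theorem evalClass_nil (T : H0Bar Γ A) : evalClass [] T = Coalgebra.counit (R := A) T := rfl

theorem eq_zero_of_forall_evalWord_edgeEval (x : Bar Γ A)
    (hx : tensorMap (lettersProj Γ A) x = x)
    (h : ∀ l : List Γ, evalWord (l.map edgeEval) x = 0) : x = 0 := by
  -- Edges do not separate letters of positive degree, so x is transported to the tensor algebra of
  -- the 1-cochains, where they do.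
  let inj : cochains Γ A (0 + 1) →ₗ[A] Letters Γ A :=
    DirectSum.lof A ℕ (fun n => cochains Γ A (n + 1)) 0
  let comp : Letters Γ A →ₗ[A] cochains Γ A (0 + 1) :=
    DirectSum.component A ℕ (fun n => cochains Γ A (n + 1)) 0
  have hy : tensorMap inj (tensorMap comp x) = x :=
    (tensorMap_comp comp inj (lettersProj Γ A) (fun _ => rfl) x).trans hx
  suffices hz : tensorMap comp x = 0 by rw [← hy, hz, map_zero]
  refine eq_zero_of_forall_evalWord (fun w : Γ => edgeEval w ∘ₗ inj) (fun c hc => ?_) _ fun l => ?_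
  · refine Subtype.ext (funext fun g => ?_)
    have := hc (g 0)
    rw [LinearMap.comp_apply, edgeEval_lof_zero] at this
    rw [show g = fun _ => g 0 from funext fun i => by fin_cases i; rfl, this]
    rfl
  · have h1 := h l
    rw [← hy, evalWord_tensorMap, List.map_map] at h1
    exact h1

theorem eq_zero_of_forall_evalClass (T : H0Bar Γ A) (h : ∀ l, evalClass l T = 0) : T = 0 :=
  H0Bar.incl_injective <| (eq_zero_of_forall_evalWord_edgeEval _ (tensorMap_proj_incl T) h).trans
    (map_zero _).symm

/-- This identifies ⟨T, w⟩ with η(τ_w T) and so turns statements on the pairing into statements on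
the action. -/
theorem counit_translate (w : Γ) (T : H0Bar Γ A) :
    Coalgebra.counit (R := A) (translate w T) = braidingNumber w T + Coalgebra.counit (R := A) T := by
  rw [translate_apply, map_add, add_comm, braidingNumber_eq]
  rfl

theorem pairing_single (T : H0Bar Γ A) (w : Γ) :
    pairing T (MonoidAlgebra.single w 1) = Coalgebra.counit (R := A) (translate w T) := by
  rw [counit_translate]
  simp [pairing]

/-- A class is determined by its functional on the group. -/
theorem eq_zero_of_forall_counit_translate (T : H0Bar Γ A)
    (h : ∀ w : Γ, Coalgebra.counit (R := A) (translate w T) = 0) : T = 0 := by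
  refine eq_zero_of_forall_evalClass T fun l => ?_
  induction l generalizing T with
  | nil => simpa [evalClass_nil] using h 1
  | cons v l ih =>
    rw [evalClass_cons]
    -- The hypothesis passes to e_v T = τ_v T - T, because τ_w τ_v = τ_{vw}.
    refine ih _ fun w => ?_
    rw [edgeContract_eq_sub, map_sub, map_sub, ← translate_mul, h, h, sub_zero]

theorem translate_eq_of_forall_counit (T : H0Bar Γ A) (v v' : Γ)
    (h : ∀ w : Γ, Coalgebra.counit (R := A) (translate (v * w) T) =
      Coalgebra.counit (R := A) (translate (v' * w) T)) : translate v T = translate v' T := by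
  rw [← sub_eq_zero]
  refine eq_zero_of_forall_counit_translate _ fun w => ?_
  rw [map_sub, map_sub, ← translate_mul, ← translate_mul, h, sub_self]

/-- The identity `rTensor_contract_deconc` descends to classes, since H⁰ ⊗ H⁰ embeds in Bar ⊗ Bar by
flatness. -/
theorem rTensor_edgeContract_comul (w : Γ) (T : H0Bar Γ A) :
    LinearMap.rTensor _ (edgeContract w) (Coalgebra.comul (R := A) T) =
      Coalgebra.comul (R := A) (edgeContract w T) := by
  have hinj : Function.Injective
      (TensorProduct.map (H0Bar.incl (Γ := Γ) (A := A)) (H0Bar.incl (Γ := Γ) (A := A))) :=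
    TensorProduct.map_injective_of_flat_flat _ _ H0Bar.incl_injective H0Bar.incl_injective
  refine hinj ?_
  rw [map_incl_comul, incl_edgeContract, ← rTensor_contract_deconc, ← map_incl_comul]
  generalize Coalgebra.comul (R := A) T = z
  induction z using TensorProduct.induction_on with
  | zero => simp
  | tmul a b => simp [incl_edgeContract]
  | add a b ha hb => simp only [map_add, ha, hb]

/-- Deconcatenation is dual to concatenation of words: letters of l are contracted from the left
factor one by one, and the counit law settles the empty word. -/
theorem mul_map_evalClass_comul (l l' : List Γ) (T : H0Bar Γ A) :
    LinearMap.mul' A A (TensorProduct.map (evalClass l) (evalClass l')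
      (Coalgebra.comul (R := A) T)) = evalClass (l ++ l') T := by
  induction l generalizing T with
  | nil =>
    have h : LinearMap.mul' A A ∘ₗ TensorProduct.map (evalClass []) (evalClass l') =
        (LinearMap.mul' A A ∘ₗ LinearMap.lTensor A (evalClass (A := A) l')) ∘ₗ
          LinearMap.rTensor _ (Coalgebra.counit (R := A) (A := H0Bar Γ A)) :=
      TensorProduct.ext' fun a b => by simp [evalClass_nil]
    have h1 := LinearMap.congr_fun h (Coalgebra.comul (R := A) T)
    simp only [LinearMap.comp_apply] at h1
    rw [h1, Coalgebra.rTensor_counit_comul]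
    simp
  | cons w l ih =>
    rw [List.cons_append, evalClass_cons, ← ih, ← rTensor_edgeContract_comul]
    generalize Coalgebra.comul (R := A) T = z
    induction z using TensorProduct.induction_on with
    | zero => simp
    | tmul a b => simp [evalClass_cons]
    | add a b ha hb => simp only [map_add, ha, hb]

theorem comul_augOne : Coalgebra.comul (R := A) (augOne Γ A) = augOne Γ A ⊗ₜ augOne Γ A := by
  have hinj : Function.Injective
      (TensorProduct.map (H0Bar.incl (Γ := Γ) (A := A)) (H0Bar.incl (Γ := Γ) (A := A))) :=
    TensorProduct.map_injective_of_flat_flat _ _ H0Bar.incl_injective H0Bar.incl_injective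
  refine hinj ?_
  rw [map_incl_comul, incl_augOne, deconc_one, TensorProduct.map_tmul, incl_augOne]

/-- The terms by which the reduced coproduct differs from the coproduct contain the class 1, on
which nonempty words vanish. -/
theorem mul_map_evalClass_redComul {l l' : List Γ} (hl : l ≠ []) (hl' : l' ≠ []) (T : H0Bar Γ A) :
    LinearMap.mul' A A (TensorProduct.map (evalClass l) (evalClass l') (redComul Γ A T)) =
      evalClass (l ++ l') T := by
  simp [redComul, reduce, comul_augOne, mul_map_evalClass_comul, evalClass_augOne hl,
    evalClass_augOne hl']

/-- The multi-evaluation is the evaluation on the corresponding word. -/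
theorem multiEval_eq {n : ℕ} (w : Fin (n + 1) → Γ) (T : H0Bar Γ A) :
    multiEval w T = evalClass (List.ofFn w) T := by
  induction n generalizing T with
  | zero =>
    rw [multiEval, LinearMap.comp_apply, iterRedComul, LinearEquiv.coe_coe,
      lift_mkPiAlgebra_subsingletonEquiv, braidingNumber_eq_evalClass]
    simp
  | succ n ih =>
    have h (z : H0Bar Γ A ⊗[A] H0Bar Γ A) :
        PiTensorProduct.lift ((MultilinearMap.mkPiAlgebra A (Fin (n + 1 + 1)) A).compLinearMap
          fun i => braidingNumber (w i)) (TensorPower.mulEquiv (TensorProduct.map (iterRedComul Γ A n)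
          (PiTensorProduct.subsingletonEquiv (R := A)
            (s := fun _ : Fin 1 => H0Bar Γ A) 0).symm.toLinearMap z)) =
        LinearMap.mul' A A (TensorProduct.map (evalClass (List.ofFn fun i => w (Fin.castSucc i)))
          (evalClass [w (Fin.last (n + 1))]) z) := by
      induction z using TensorProduct.induction_on with
      | zero => simp
      | add a b ha hb => simp only [map_add, ha, hb]
      | tmul a b =>
        rw [TensorProduct.map_tmul, lift_mkPiAlgebra_mulEquiv, LinearEquiv.coe_coe,
          lift_mkPiAlgebra_subsingletonEquiv, TensorProduct.map_tmul, LinearMap.mul'_apply,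
          ← ih, ← braidingNumber_eq_evalClass]
        rfl
    -- The recursion for `iterRedComul` splits off the last tensor factor, so the word is split at
    -- its last letter.
    refine (h (redComul Γ A T)).trans ?_
    rw [mul_map_evalClass_redComul (by simp) (by simp), List.ofFn_succ' w, List.concat_eq_append]

end Evaluation
-- Descent of classes along a surjection of groups
section Lifting
variable {A : Type*} [CommRing A] [IsDomain A] [IsPrincipalIdealRing A]
  {Γ : Type*} [Group Γ] {Γ' : Type*} [Group Γ']

theorem pullback_apply (h : Γ →* Γ') (S : H0Bar Γ' A) : pullback A h S = pullbackLinear h S := rfl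

theorem pullback_injective (h : Γ →* Γ') (hh : Function.Surjective h) :
    Function.Injective (pullback A h) := fun _ _ hxy =>
  H0Bar.incl_injective (barMap_injective h hh (congrArg H0Bar.incl hxy))

theorem isSubcoalgebra_range_pullback (h : Γ →* Γ') :
    IsSubcoalgebra (A := A) (LinearMap.range (pullback A h).toLinearMap) := by
  rintro _ ⟨S, rfl⟩
  have h1 := LinearMap.congr_fun (pullback A h).map_comp_comul S
  have h2 : Coalgebra.comul (R := A) ((pullback A h).toLinearMap S) =
      TensorProduct.map (pullback A h).toLinearMap (pullback A h).toLinearMap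
        (Coalgebra.comul (R := A) S) := h1.symm
  rw [h2]
  generalize Coalgebra.comul (R := A) S = z
  induction z using TensorProduct.induction_on with
  | zero => rw [map_zero]; exact zero_mem _
  | tmul a b => exact ⟨⟨_, LinearMap.mem_range_self _ a⟩ ⊗ₜ ⟨_, LinearMap.mem_range_self _ b⟩, rfl⟩
  | add a b ha hb => rw [map_add]; exact add_mem ha hb

theorem edgeContract_pullback (h : Γ →* Γ') (w : Γ) (S : H0Bar Γ' A) :
    edgeContract w (pullback A h S) = pullback A h (edgeContract (h w) S) := by
  refine H0Bar.incl_injective ?_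
  rw [incl_edgeContract, pullback_apply, pullback_apply, incl_pullbackLinear, incl_pullbackLinear,
    incl_edgeContract, barMap, contract_tensorMap, lettersMap_eq_lettersPull, edgeEval_lettersPull]

theorem counit_pullback (h : Γ →* Γ') (S : H0Bar Γ' A) :
    Coalgebra.counit (R := A) (pullback A h S) = Coalgebra.counit (R := A) S :=
  LinearMap.congr_fun (pullback A h).counit_comp S

theorem braidingNumber_pullback (h : Γ →* Γ') (w : Γ) (S : H0Bar Γ' A) :
    braidingNumber w (pullback A h S) = braidingNumber (h w) S := by
  rw [braidingNumber_eq_evalClass, braidingNumber_eq_evalClass, evalClass_cons, evalClass_cons,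
    edgeContract_pullback, evalClass_nil, evalClass_nil, counit_pullback]

theorem pullback_augOne (h : Γ →* Γ') : pullback A h (augOne Γ' A) = augOne Γ A :=
  H0Bar.incl_injective (map_one (barMap h))

theorem redComul_pullback (h : Γ →* Γ') (S : H0Bar Γ' A) : redComul Γ A (pullback A h S) =
    TensorProduct.map (pullback A h).toLinearMap (pullback A h).toLinearMap (redComul Γ' A S) := by
  have h1 (S : H0Bar Γ' A) : Coalgebra.comul (R := A) (pullback A h S) =
      TensorProduct.map (pullback A h).toLinearMap (pullback A h).toLinearMap
        (Coalgebra.comul (R := A) S) := (LinearMap.congr_fun (pullback A h).map_comp_comul S).symm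
  have h2 : reduce Γ A (pullback A h S) = pullback A h (reduce Γ' A S) := by
    simp only [reduce, LinearMap.sub_apply, LinearMap.id_apply, LinearMap.comp_apply,
      LinearMap.toSpanSingleton_apply, counit_pullback, map_sub, map_smul, pullback_augOne]
  simp only [redComul, LinearMap.comp_apply, h2, LinearMap.sub_apply, h1, map_sub,
    TensorProduct.mk_apply, LinearMap.flip_apply, TensorProduct.map_tmul]
  erw [pullback_augOne]
  rfl

/-- A class on which translation by `Γ` factors through `Γ'` is pulled back from `Γ'`. -/
theorem mem_range_pullback (h : Γ →* Γ') (hh : Function.Surjective h) (T : H0Bar Γ A)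
    (hT : ∀ v w : Γ, h v = h w →
      Coalgebra.counit (R := A) (translate v T) = Coalgebra.counit (R := A) (translate w T)) :
    T ∈ LinearMap.range (pullback A h).toLinearMap := by
  classical
  let s : Γ' → Γ := fun g => if g = 1 then 1 else Function.surjInv hh g
  have hs : s 1 = 1 := by simp [s]
  have hsec (g : Γ') : h (s g) = g := by
    by_cases hg : g = 1
    · simp [s, hg]
    · simp [s, hg, Function.surjInv_eq hh]
  -- The candidate for the lift is s^*T. It has degree zero; that it is a cocycle is known only once
  -- it is seen to pull back to T.
  let f : Letters Γ A →ₗ[A] Letters Γ' A := lettersPull s hs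
  have hfg (w : Γ) : edgeEval w ∘ₗ lettersMap h ∘ₗ f = edgeEval (A := A) (s (h w)) := by
    rw [← LinearMap.comp_assoc, lettersMap_eq_lettersPull, edgeEval_lettersPull]
    exact edgeEval_lettersPull s hs (h w)
  have hcomp (x : Bar Γ A) : barMap h (tensorMap f x) = tensorMap (lettersMap h ∘ₗ f) x :=
    tensorMap_comp f (lettersMap h) (lettersMap h ∘ₗ f) (fun _ => rfl) x
  -- By `hfg`, evaluating h^*s^*T replaces each letter w by s(h(w)). Since w and s(h(w)) have the
  -- same image, they contract an invariant class in the same way.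
  have hword (l : List Γ) (T : H0Bar Γ A) (hT : ∀ v w : Γ, h v = h w →
      Coalgebra.counit (R := A) (translate v T) = Coalgebra.counit (R := A) (translate w T)) :
      evalWord (l.map edgeEval) (tensorMap (lettersMap h ∘ₗ f) T.incl) =
        evalWord (l.map edgeEval) T.incl := by
    induction l generalizing T with
    | nil => exact algebraMapInv_tensorMap _ _
    | cons w l ih =>
      have h1 : edgeContract (s (h w)) T = edgeContract w T := by
        rw [edgeContract_eq_sub, edgeContract_eq_sub,
          translate_eq_of_forall_counit T (s (h w)) w fun v => hT _ _ (by simp [hsec])]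
      rw [List.map_cons, evalWord, LinearMap.comp_apply, LinearMap.comp_apply, contract_tensorMap,
        hfg, ← incl_edgeContract, ← incl_edgeContract, h1]
      -- Invariance passes to e_w T: the value of e_w T at v is the value of T at wv minus its value
      -- at v.
      refine ih _ fun v v' hv => ?_
      rw [edgeContract_eq_sub, map_sub, map_sub, map_sub, map_sub, ← translate_mul, ← translate_mul,
        hT v v' hv, hT (w * v) (w * v') (by simp [hv])]
  have hdeg : tensorMap (lettersProj Γ' A) (tensorMap f T.incl) = tensorMap f T.incl := by
    conv_rhs => rw [← tensorMap_proj_incl T]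
    rw [tensorMap_comp f _ (lettersProj Γ' A ∘ₗ f) (fun _ => rfl),
      tensorMap_comp _ f (lettersProj Γ' A ∘ₗ f) (fun c => (lettersPull_proj s hs c).symm)]
  have hback : barMap h (tensorMap f T.incl) = T.incl := by
    rw [← sub_eq_zero]
    refine eq_zero_of_forall_evalWord_edgeEval _ ?_ fun l => ?_
    · rw [map_sub, tensorMap_proj_incl, barMap, tensorMap_comp (lettersMap h) _
        (lettersMap h ∘ₗ lettersProj Γ' A) (lettersMap_proj h),
        ← tensorMap_comp (lettersProj Γ' A) (lettersMap h) _ (fun _ => rfl), hdeg]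
    · rw [map_sub, hcomp, hword l T hT, sub_self]
  refine ⟨⟨tensorMap f T.incl, (mem_barDegree_zero _).2 hdeg, ?_⟩, H0Bar.incl_injective hback⟩
  -- The image of d(s^*T) under the injective map h^* is dT = 0.
  refine LinearMap.mem_ker.2 (barMap_injective (A := A) h hh ?_)
  rw [← barD_barMap, hback, barD_incl, map_zero]

theorem pairing_factors_iff (h : Γ →* Γ') (hh : Function.Surjective h) (T : H0Bar Γ A) :
    (∃ φ : MonoidAlgebra A Γ' →ₗ[A] A, pairing T = φ ∘ₗ MonoidAlgebra.mapDomainLinearMap A A h) ↔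
    ∀ v w : Γ, h v = h w →
      Coalgebra.counit (R := A) (translate v T) = Coalgebra.counit (R := A) (translate w T) := by
  constructor
  · rintro ⟨φ, hφ⟩ v w hvw
    rw [← pairing_single, ← pairing_single, hφ]
    simp [hvw]
  · intro hT
    refine ⟨pairing T ∘ₗ MonoidAlgebra.mapDomainLinearMap A A (Function.surjInv hh), ?_⟩
    ext w
    simp only [LinearMap.comp_apply, MonoidAlgebra.lsingle_apply,
      MonoidAlgebra.mapDomainLinearMap_single, pairing_single]
    exact hT _ _ (Function.surjInv_eq hh _).symm

/-- By `braidingNumber_mul`, the first hypothesis makes ℓ_T additive on products with one factor in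
⟨R⟩. So ℓ_T vanishes on ⟨R⟩ once it vanishes on R, and then it is constant on cosets. -/
theorem counit_translate_eq_of_mem_normalClosure (R : Set Γ) (T : H0Bar Γ A)
    (hmul : ∀ v, ∀ k ∈ Subgroup.normalClosure R,
      evalClass [v, k] T = 0 ∧ evalClass [k, v] T = 0)
    (hR : ∀ r ∈ R, braidingNumber r T = 0) {v w : Γ}
    (hvw : QuotientGroup.mk' (Subgroup.normalClosure R) v =
      QuotientGroup.mk' (Subgroup.normalClosure R) w) :
    Coalgebra.counit (R := A) (translate v T) = Coalgebra.counit (R := A) (translate w T) := by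
  have hr (v k : Γ) (hk : k ∈ Subgroup.normalClosure R) :
      braidingNumber (v * k) T = braidingNumber v T + braidingNumber k T := by
    rw [braidingNumber_mul, (hmul v k hk).1, add_zero]
  have hl (v k : Γ) (hk : k ∈ Subgroup.normalClosure R) :
      braidingNumber (k * v) T = braidingNumber k T + braidingNumber v T := by
    rw [braidingNumber_mul, (hmul v k hk).2, add_zero]
  have hN (k : Γ) (hk : k ∈ Subgroup.normalClosure R) : braidingNumber k T = 0 := by
    induction hk using Subgroup.closure_induction with
    | mem x hx =>
      obtain ⟨r, hrR, hx⟩ := Group.mem_conjugatesOfSet_iff.1 hx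
      obtain ⟨g, rfl⟩ := isConj_iff.1 hx
      have hrN := Subgroup.subset_normalClosure hrR
      -- Compute ℓ_T(gr) in two ways, from gr = (grg⁻¹)g and from gr = g·r; subtracting ℓ_T(g) shows
      -- that the conjugate has the value ℓ_T(r) = 0.
      have h1 := hl g _ (Subgroup.normalClosure_normal.conj_mem r hrN g)
      rw [inv_mul_cancel_right, hr g r hrN, hR r hrR, add_zero] at h1
      simpa using h1
    | one => exact braidingNumber_one T
    | mul x y hx hy h1 h2 => rw [hr x y hy, h1, h2, add_zero]
    | inv x hx h1 =>
      have h2 := hr x⁻¹ x hx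
      rw [inv_mul_cancel, braidingNumber_one, h1, add_zero] at h2
      exact h2.symm
  have hk : v⁻¹ * w ∈ Subgroup.normalClosure R := QuotientGroup.eq.1 hvw
  rw [counit_translate, counit_translate, ← mul_inv_cancel_left v w, hr v _ hk, hN _ hk, add_zero]

/-- The vanishing hypothesis is inherited by all τ_g T. Hence r in R fixes every translate of T, so
each conjugate of r fixes T, and so does the group they generate. -/
theorem translate_eq_of_forall_evalClass (R : Set Γ) (T : H0Bar Γ A)
    (hT : ∀ l : List Γ, (∃ r ∈ l, r ∈ R) → evalClass l T = 0) {k : Γ}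
    (hk : k ∈ Subgroup.normalClosure R) : translate k T = T := by
  have hstab (g : Γ) (T : H0Bar Γ A) (hT : ∀ l : List Γ, (∃ r ∈ l, r ∈ R) → evalClass l T = 0)
      (l : List Γ) (hl : ∃ r ∈ l, r ∈ R) : evalClass l (translate g T) = 0 := by
    rw [translate_apply, map_add, ← evalClass_cons, hT l hl, hT (g :: l) (by
      obtain ⟨r, h1, h2⟩ := hl
      exact ⟨r, List.mem_cons_of_mem g h1, h2⟩), add_zero]
  induction hk using Subgroup.closure_induction generalizing T with
  | mem x hx =>
    obtain ⟨r, hrR, hx⟩ := Group.mem_conjugatesOfSet_iff.1 hx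
    obtain ⟨g, rfl⟩ := isConj_iff.1 hx
    -- Every evaluation of e_r τ_g T is an evaluation of τ_g T on a word beginning with r.
    have h1 : translate r (translate g T) = translate g T := by
      rw [← sub_eq_zero, ← edgeContract_eq_sub]
      refine eq_zero_of_forall_evalClass _ fun l => ?_
      rw [← evalClass_cons]
      exact hstab g T hT _ ⟨r, List.mem_cons_self, hrR⟩
    rw [translate_mul, translate_mul, h1, ← translate_mul, mul_inv_cancel, translate_one]
  | one => exact translate_one T
  | mul x y _ _ h1 h2 => rw [translate_mul, h1 T hT, h2 T hT]
  | inv x _ h1 =>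
    have h2 := h1 T hT
    conv_lhs => rw [← h2]
    rw [← translate_mul, mul_inv_cancel, translate_one]

/-- The letters before the first one in the kernel preserve invariance, and that one contracts an
invariant class to τ_1 - τ_1 = 0. -/
theorem evalClass_eq_zero_of_translate (h : Γ →* Γ') (T : H0Bar Γ A)
    (hT : ∀ v w : Γ, h v = h w →
      Coalgebra.counit (R := A) (translate v T) = Coalgebra.counit (R := A) (translate w T))
    (l : List Γ) (hl : ∃ r ∈ l, h r = 1) : evalClass l T = 0 := by
  induction l generalizing T with
  | nil => simp at hl
  | cons w l ih =>
    rw [evalClass_cons]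
    by_cases hw : h w = 1
    · rw [edgeContract_eq_sub, translate_eq_of_forall_counit T w 1 fun v => hT _ _ (by simp [hw]),
        translate_one, sub_self, map_zero]
    · refine ih _ (fun v v' hv => ?_) ?_
      · rw [edgeContract_eq_sub, map_sub, map_sub, map_sub, map_sub, ← translate_mul,
          ← translate_mul, hT v v' hv, hT (w * v) (w * v') (by simp [hv])]
      · obtain ⟨r, hr, h1⟩ := hl
        rcases List.mem_cons.1 hr with rfl | hr
        · exact absurd h1 hw
        · exact ⟨r, hr, h1⟩

end Lifting
end LetterBraiding
end

/-! ### The lifting criterion -/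

theorem theorem5p4 {A : Type*} [CommRing A] [IsDomain A] [IsPrincipalIdealRing A]
    {Γ₀ : Type*} [Group Γ₀] (R : Set Γ₀) :
    let p := QuotientGroup.mk' (Subgroup.normalClosure R)
    Function.Injective (pullback A p) ∧
    IsSubcoalgebra (A := A) (LinearMap.range (pullback A p).toLinearMap) ∧
    ∀ T : H0Bar Γ₀ A, Coalgebra.counit (R := A) T = 0 →
      List.TFAE [
        T ∈ LinearMap.range (pullback A p).toLinearMap,
        (∃ (m : ℕ) (T₁ T₂ : Fin m → H0Bar Γ₀ A),
          (∀ i, T₁ i ∈ LinearMap.range (pullback A p).toLinearMap) ∧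
          (∀ i, T₂ i ∈ LinearMap.range (pullback A p).toLinearMap) ∧
          redComul Γ₀ A T = ∑ i, T₁ i ⊗ₜ[A] T₂ i) ∧
          (∀ r ∈ R, braidingNumber r T = 0),
        ∃ φ : MonoidAlgebra A (Γ₀ ⧸ Subgroup.normalClosure R) →ₗ[A] A,
          pairing T = φ ∘ₗ MonoidAlgebra.mapDomainLinearMap A A p,
        ∀ (n : ℕ) (w : Fin (n + 1) → Γ₀), (∃ i, w i ∈ R) → multiEval w T = 0] := by
  intro p
  have hp : Function.Surjective p := QuotientGroup.mk'_surjective _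
  have hker {k : Γ₀} (hk : k ∈ Subgroup.normalClosure R) : p k = 1 :=
    (QuotientGroup.eq_one_iff k).2 hk
  have hrel {r : Γ₀} (hr : r ∈ R) : p r = 1 := hker (Subgroup.subset_normalClosure hr)
  refine ⟨pullback_injective p hp, isSubcoalgebra_range_pullback p, fun T _ => ?_⟩
  tfae_have 1 → 2 := by
    rintro ⟨S, rfl⟩
    refine ⟨?_, fun r hr => ?_⟩
    · obtain ⟨m, S₁, S₂, hS⟩ := TensorProduct.exists_sum_tmul_eq (redComul _ A S)
      refine ⟨m, fun i => pullback A p (S₁ i), fun i => pullback A p (S₂ i),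
        fun i => ⟨S₁ i, rfl⟩, fun i => ⟨S₂ i, rfl⟩, ?_⟩
      refine (redComul_pullback p S).trans ?_
      rw [hS, map_sum]
      rfl
    · refine (braidingNumber_pullback p r S).trans ?_
      rw [hrel hr, braidingNumber_one]
  tfae_have 2 → 3 := by
    rintro ⟨⟨m, T₁, T₂, h₁, h₂, hT⟩, hR⟩
    have hzero {S : H0Bar Γ₀ A} (hS : S ∈ LinearMap.range (pullback A p).toLinearMap) {k : Γ₀}
        (hk : k ∈ Subgroup.normalClosure R) : evalClass [k] S = 0 := by
      obtain ⟨S, rfl⟩ := hS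
      rw [← braidingNumber_eq_evalClass]
      refine (braidingNumber_pullback p k S).trans ?_
      rw [hker hk, braidingNumber_one]
    -- Each summand is a product of braiding numbers of pulled-back classes, which vanish on ⟨R⟩ by
    -- `hzero`. This supplies both vanishing conditions required below.
    have heval (a b : Γ₀) :
        evalClass [a, b] T = ∑ i, evalClass [a] (T₁ i) * evalClass [b] (T₂ i) := by
      have h := mul_map_evalClass_redComul (List.cons_ne_nil a []) (List.cons_ne_nil b []) T
      rw [hT] at h
      simpa using h.symm
    refine (pairing_factors_iff p hp T).2 fun v w hvw =>
      counit_translate_eq_of_mem_normalClosure R T (fun v k hk => ⟨?_, ?_⟩) hR hvw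
    · simp [heval, hzero (h₂ _) hk]
    · simp [heval, hzero (h₁ _) hk]
  tfae_have 3 → 1 := fun h => mem_range_pullback p hp T ((pairing_factors_iff p hp T).1 h)
  tfae_have 3 → 4 := by
    rintro h n w ⟨i, hi⟩
    rw [multiEval_eq]
    exact evalClass_eq_zero_of_translate p T ((pairing_factors_iff p hp T).1 h) _
      ⟨w i, List.mem_ofFn.2 ⟨i, rfl⟩, hrel hi⟩
  tfae_have 4 → 3 := by
    intro h
    have hword (l : List Γ₀) (hl : ∃ r ∈ l, r ∈ R) : evalClass l T = 0 := by
      obtain ⟨r, hr, hrR⟩ := hl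
      obtain ⟨n, w, rfl⟩ : ∃ (n : ℕ) (w : Fin (n + 1) → Γ₀), l = List.ofFn w := by
        cases l with
        | nil => simp at hr
        | cons a l => exact ⟨l.length, (a :: l).get, (List.ofFn_get _).symm⟩
      obtain ⟨i, rfl⟩ := List.mem_ofFn.1 hr
      rw [← multiEval_eq]
      exact h n w ⟨i, hrR⟩
    refine (pairing_factors_iff p hp T).2 fun v w hvw => ?_
    -- The element of ⟨R⟩ must stand on the left in w = (wv⁻¹)v, because the left factor acts first
    -- and is known to fix T itself.
    have hk : w * v⁻¹ ∈ Subgroup.normalClosure R := by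
      refine (QuotientGroup.eq_one_iff _).1 ?_
      change p (w * v⁻¹) = 1
      rw [map_mul, map_inv, hvw, mul_inv_cancel]
    conv_rhs => rw [← inv_mul_cancel_right w v, translate_mul,
      translate_eq_of_forall_evalClass R T hword hk]
  tfae_finish
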